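/- Let $d\ge 2$. For $d+1$ affinely independent points of $\mathbf R^d$, their open circumball is the open ball whose boundary sphere contains all of them. Let $\chi\subset\mathbf R^d$. A Delaunay simplex of $\chi$ is a set of $d+1$ affinely independent points of $\chi$ whose open circumball contains no point of $\chi$. The Delaunay graph of $\chi$ joins two distinct points of $\chi$ whenever they are vertices of a common Delaunay simplex; $d_\chi(x)$ denotes the degree of $x$ in this graph. The Voronoi flower $F_\chi(x)$ is the union of the open circumballs of all Delaunay simplices of $\chi$ having $x$ as a vertex. For $y_{1:k}=(y_1,\dots,y_k)\in(\mathbf R^d)^k$ let $\Phi_{y_{1:k}}(0)$ be the Lebesgue measure of $F_{\{0,y_1,\dots,y_k\}}(0)$. Let $C_k\subset(\mathbf R^d)^k$ be the set of $k$-tuples in convex position, that is, of $k$-tuples of distinct points $y_1,\dots,y_k$ such that $0$ is joined to every $y_i$ in the Delaunay graph of $\{0,y_1,\dots,y_k\}$ and $0$ lies in the interior of the convex hull of $\{y_1,\dots,y_k\}$. Let $\eta$ be a stationary Poisson point process of intensity $1$ in $\mathbf R^d$, and let $B\subset\mathbf R^d$ be a Borel set whose Lebesgue measure $V_d(B)$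 satisfies $0<V_d(B)<\infty$. The distribution of the typical degree $\mathcal D^0$ is defined by $$\mathbf P(\mathcal D^0=k)=\frac1{V_d(B)}\,\mathbf E\Big[\sum_{x\in\eta\cap B}\mathbf 1\{d_\eta(x)=k\}\Big].$$ Then, for every such $B$ and every integer $k\ge 1$, $$\mathbf P(\mathcal D^0=k)=\int_{C_k}\mathbf 1\{\Phi_{y_{1:k}}(0)\le 1\}\,\mathrm dy_{1:k}.$$ -/

import Mathlib

open MeasureTheory ProbabilityTheory Set
open scoped ENNReal NNReal

/-- The Euclidean space `ℝ^d`, with the Euclidean norm and Lebesgue measure. -/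
abbrev Space (d : ℕ) : Type := EuclideanSpace ℝ (Fin d)

noncomputable section

/-- The open circumball of `d + 1` affinely independent points of `ℝ^d`. -/
def circumball {d : ℕ} (s : Affine.Simplex ℝ (Space d) d) : Set (Space d) :=
  Metric.ball s.circumcenter s.circumradius

/-- `s` is a Delaunay simplex of `χ`: its vertices belong to `χ` and its open circumball contains
no point of `χ`. -/
def IsDelaunaySimplex {d : ℕ} (χ : Set (Space d)) (s : Affine.Simplex ℝ (Space d) d) : Prop :=
  range s.points ⊆ χ ∧ circumball s ∩ χ = ∅

/-- The Delaunay graph of `χ`, seen as a graph on `ℝ^d` all of whose edges join points of `χ`: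
two points are joined if they are distinct vertices of a common Delaunay simplex. -/
def delaunayGraph {d : ℕ} (χ : Set (Space d)) : SimpleGraph (Space d) where
  Adj x y := x ≠ y ∧ ∃ s : Affine.Simplex ℝ (Space d) d,
    IsDelaunaySimplex χ s ∧ x ∈ range s.points ∧ y ∈ range s.points
  symm := ⟨fun _ _ ⟨hne, s, hs, hx, hy⟩ => ⟨hne.symm, s, hs, hy, hx⟩⟩
  loopless := ⟨fun _ h => h.1 rfl⟩

/-- The degree of `x` in the Delaunay graph of `χ` (possibly infinite). -/
def delaunayDegree {d : ℕ} (χ : Set (Space d)) (x : Space d) : ℕ∞ :=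
  ((delaunayGraph χ).neighborSet x).encard

/-- The Voronoi flower of `χ` at `x`: the union of the open circumballs of the Delaunay simplices
of `χ` having `x` as a vertex. -/
def voronoiFlower {d : ℕ} (χ : Set (Space d)) (x : Space d) : Set (Space d) :=
  ⋃ (s : Affine.Simplex ℝ (Space d) d) (_ : IsDelaunaySimplex χ s) (_ : x ∈ range s.points),
    circumball s

/-- The `Φ`-content of `x`: the volume of its Voronoi flower. -/
def phiContent {d : ℕ} (χ : Set (Space d)) (x : Space d) : ℝ≥0∞ :=
  volume (voronoiFlower χ x)

/-- The set `C_k` of `k`-tuples in convex position: tuples of distinct points, all of which are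
Delaunay neighbours of `0` in `{0, x_1, …, x_k}`, and which surround `0`, that is, `0` is in the
interior of their convex hull (equivalently, the Voronoi cell of `0` is bounded). -/
def convexPosition (d k : ℕ) : Set (Fin k → Space d) :=
  {x | Function.Injective x ∧
    (∀ i, (delaunayGraph (insert 0 (range x))).Adj 0 (x i)) ∧
    (0 : Space d) ∈ interior (convexHull ℝ (range x))}

/-- `η` is a stationary Poisson point process of intensity `1` in `ℝ^d`, seen as a random locally
finite set: the number of points in a Borel set of finite volume `v` is Poisson distributed with
mean `v`, and the numbers of points in finitely many pairwise disjoint Borel sets are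
independent. -/
structure IsUnitPoissonProcess {d : ℕ} {Ω : Type*} [MeasurableSpace Ω]
    (P : Measure Ω) (η : Ω → Set (Space d)) : Prop where
  locallyFinite : ∀ ω (B : Set (Space d)), Bornology.IsBounded B → (η ω ∩ B).Finite
  measurable_count : ∀ B : Set (Space d), MeasurableSet B →
    Measurable fun ω => (η ω ∩ B).encard
  law_count : ∀ B : Set (Space d), MeasurableSet B → volume B ≠ ∞ → ∀ n : ℕ,
    P {ω | (η ω ∩ B).encard = n} = poissonMeasure (volume B).toNNReal {n}
  indep_count : ∀ (n : ℕ) (B : Fin n → Set (Space d)), (∀ i, MeasurableSet (B i)) →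
    Pairwise (fun i j => Disjoint (B i) (B j)) →
    iIndepFun (fun i ω => (η ω ∩ B i).encard) P

/-- The probability that the typical degree is `k`, defined through the window `B`: the expected
number of points of `η` in `B` with Delaunay degree `k`, per unit volume. -/
def typicalDegreeProb {d : ℕ} {Ω : Type*} [MeasurableSpace Ω]
    (P : Measure Ω) (η : Ω → Set (Space d)) (B : Set (Space d)) (k : ℕ) : ℝ≥0∞ :=
  (volume B)⁻¹ * ∫⁻ ω, ∑' x : ↥(η ω ∩ B),
    {x : Space d | delaunayDegree (η ω) x = k}.indicator (fun _ => 1) (x : Space d) ∂P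

end

/-! ### Voronoi cells and Delaunay neighbours of the origin. -/

section Geometry

variable {d : ℕ}

/-! Almost surely, a point `x` of `η` has degree `k` exactly when some `k` points of `η`, seen from
`x`, are in convex position and have a flower free of points of `η`; these `k` points are then
precisely its neighbours. Each such `x` is counted `k!` times by ordered tuples. So the expected
number of such points in `B` is `1 / k!` times the expected number of tuples with an empty flower.
By a Mecke formula and translation invariance it equals `V_d(B) / k!` times the integral of `exp
(-Φ)` over `C_k`. Finally `C_k` is a cone and `Φ` is homogeneous of degree `d`, so the part of `C_k`
where `Φ ≤ t` has volume `t ^ k` times that of the part where `Φ ≤ 1`. Integrating against `exp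
(-t)` produces a factor `k!`, which cancels.

The deterministic characterisation is `eq_frameNeighbors_iff`. The Voronoi cell of the origin is cut
out by the constraints `2⟨w, y⟩ ≤ ‖y‖²`; its extreme points are circumcentres of Delaunay simplices,
and a linear functional on a compact cell is maximised at one of them. Compactness comes from
`ae_isSurrounding`, and `ae_isGenericAt` excludes further points on a circumsphere.

The Mecke formula `lintegral_tupleMeasure` is built from independence of counts. A set depending on
the tuple, required to be empty, is written as a countable union of rectangles
(`exists_rectangles`); finitely many rectangles are handled by induction, starting from the
factorial moments `setLIntegral_tupleMeasure`, and the rest by a limit. The scaling step is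
`lintegral_voidProb_convexPosition`. -/

lemma norm_le_norm_sub_iff_two_inner_le (w y : Space d) :
    ‖w‖ ≤ ‖w - y‖ ↔ 2 * inner ℝ w y ≤ ‖y‖ ^ 2 := by
  rw [← sq_le_sq₀ (norm_nonneg _) (norm_nonneg _), norm_sub_sq_real]
  constructor <;> intro h <;> linarith

lemma norm_sub_eq_norm_iff_two_inner_eq (w y : Space d) :
    ‖w - y‖ = ‖w‖ ↔ 2 * inner ℝ w y = ‖y‖ ^ 2 := by
  rw [← sq_eq_sq₀ (norm_nonneg _) (norm_nonneg _), norm_sub_sq_real]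
  constructor <;> intro h <;> linarith

/-- The Voronoi cell of `0` with respect to `S`. -/
def voronoiCell (S : Set (Space d)) : Set (Space d) := {w | ∀ y ∈ S, ‖w‖ ≤ ‖w - y‖}

/-- `b` and `0` are the vertices of a Delaunay simplex of `S ∪ {0}` with circumcenter `c`. -/
structure IsDelaunayFrame (S : Set (Space d)) (b : Fin d → Space d) (c : Space d) : Prop where
  linearIndependent : LinearIndependent ℝ b
  mem : ∀ i, b i ∈ S
  dist_eq : ∀ i, ‖c - b i‖ = ‖c‖
  center_mem : c ∈ voronoiCell S

/-- The Delaunay neighbours of `0` in `S ∪ {0}`. -/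
def frameNeighbors (S : Set (Space d)) : Set (Space d) :=
  {y | ∃ b c, IsDelaunayFrame S b c ∧ y ∈ range b}

/-- A set having finitely many points in each ball around `0`. -/
def IsLocFinite (S : Set (Space d)) : Prop := ∀ R : ℝ, (S ∩ Metric.closedBall 0 R).Finite

lemma frameNeighbors_subset (S : Set (Space d)) : frameNeighbors S ⊆ S := by
  rintro y ⟨b, c, h, i, rfl⟩
  exact h.mem i

lemma frameNeighbors_ne_zero {S : Set (Space d)} {y : Space d} (h : y ∈ frameNeighbors S) :
    y ≠ 0 := by
  obtain ⟨b, c, h, i, rfl⟩ := h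
  exact h.linearIndependent.ne_zero i

lemma voronoiCell_anti {S T : Set (Space d)} (h : S ⊆ T) : voronoiCell T ⊆ voronoiCell S :=
  fun _ hw y hy => hw y (h hy)

lemma zero_mem_voronoiCell (S : Set (Space d)) : (0 : Space d) ∈ voronoiCell S := by
  intro y _
  simp

lemma isClosed_voronoiCell (S : Set (Space d)) : IsClosed (voronoiCell S) := by
  have : voronoiCell S = ⋂ y ∈ S, {w | ‖w‖ ≤ ‖w - y‖} := by ext; simp [voronoiCell]
  rw [this]
  exact isClosed_biInter fun y _ => isClosed_le continuous_norm (by fun_prop)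

/-- A point of the cell can be moved inside the cell in any direction `u` along which no active
constraint becomes violated. -/
lemma exists_pos_add_smul_mem_voronoiCell {S : Set (Space d)} (hS : IsLocFinite S)
    {v : Space d} (hv : v ∈ voronoiCell S) {u : Space d}
    (hu : ∀ y ∈ S, ‖v - y‖ = ‖v‖ → inner ℝ u y ≤ 0) :
    ∃ ε > (0 : ℝ), ∀ t : ℝ, 0 ≤ t → t ≤ ε → v + t • u ∈ voronoiCell S := by
  -- For `t ≤ 1` the moved point has norm at most `‖v‖ + ‖u‖`, so by Cauchy–Schwarz a constraint `y`
  -- with `‖y‖` beyond twice this bound cannot be violated. Only finitely many remain.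
  have hfin := hS (2 * (‖v‖ + ‖u‖))
  have key : ∀ y ∈ S ∩ Metric.closedBall 0 (2 * (‖v‖ + ‖u‖)), ∀ᶠ t in nhdsWithin (0 : ℝ) (Ici 0),
      2 * inner ℝ (v + t • u) y ≤ ‖y‖ ^ 2 := by
    intro y hy
    by_cases hact : ‖v - y‖ = ‖v‖
    · have h1 := hu y hy.1 hact
      filter_upwards [self_mem_nhdsWithin] with t ht
      rw [norm_sub_eq_norm_iff_two_inner_eq] at hact
      rw [inner_add_left, real_inner_smul_left]
      have : t * inner ℝ u y ≤ 0 := mul_nonpos_of_nonneg_of_nonpos ht h1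
      linarith
    · have h1 : 2 * inner ℝ v y < ‖y‖ ^ 2 := by
        refine lt_of_le_of_ne ((norm_le_norm_sub_iff_two_inner_le v y).1 (hv y hy.1)) ?_
        rwa [Ne, ← norm_sub_eq_norm_iff_two_inner_eq]
      have hc : ContinuousAt (fun t : ℝ => 2 * inner ℝ (v + t • u) y) 0 := by fun_prop
      have := hc.eventually_lt (continuousAt_const (y := ‖y‖ ^ 2)) (by simpa using h1)
      exact (this.mono fun t ht => ht.le).filter_mono nhdsWithin_le_nhds
  have hall := (Filter.eventually_all_finite hfin).2 key
  rw [eventually_nhdsWithin_iff, Metric.eventually_nhds_iff] at hall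
  obtain ⟨ε, hε, hall⟩ := hall
  refine ⟨min 1 (ε / 2), by positivity, fun t ht0 ht y hy => ?_⟩
  rw [norm_le_norm_sub_iff_two_inner_le]
  by_cases hyb : ‖y‖ ≤ 2 * (‖v‖ + ‖u‖)
  · refine hall ?_ ht0 y ⟨hy, by simpa using hyb⟩
    rw [Real.dist_eq, sub_zero, abs_of_nonneg ht0]
    have := ht.trans (min_le_right _ _)
    linarith
  · have h1 : ‖v + t • u‖ ≤ ‖v‖ + ‖u‖ := by
      refine (norm_add_le _ _).trans ?_
      rw [norm_smul, Real.norm_of_nonneg ht0]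
      nlinarith [norm_nonneg u, ht.trans (min_le_left _ _)]
    have h2 := real_inner_le_norm (v + t • u) y
    nlinarith [norm_nonneg y, norm_nonneg (v + t • u)]

/-- At an extreme point of the Voronoi cell, the active constraints span the space. -/
lemma span_active_eq_top {S : Set (Space d)} (hS : IsLocFinite S) {v : Space d}
    (hv : v ∈ (voronoiCell S).extremePoints ℝ) :
    Submodule.span ℝ {y ∈ S | ‖v - y‖ = ‖v‖} = ⊤ := by
  by_contra hne
  have hperp : (Submodule.span ℝ {y ∈ S | ‖v - y‖ = ‖v‖})ᗮ ≠ ⊥ := by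
    rwa [Ne, Submodule.orthogonal_eq_bot_iff]
  obtain ⟨u, hu, hu0⟩ := Submodule.exists_mem_ne_zero_of_ne_bot hperp
  have hu' : ∀ y ∈ S, ‖v - y‖ = ‖v‖ → inner ℝ u y = 0 := fun y hy hact =>
    (Submodule.mem_orthogonal' _ u).1 hu y (Submodule.subset_span ⟨hy, hact⟩)
  -- As `u` is orthogonal to all active points, `v` can move along both `u` and `-u`; it is then a
  -- midpoint of two points of the cell.
  obtain ⟨ε₁, hε₁, h₁⟩ := exists_pos_add_smul_mem_voronoiCell hS hv.1
    fun y hy hact => (hu' y hy hact).le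
  obtain ⟨ε₂, hε₂, h₂⟩ := exists_pos_add_smul_mem_voronoiCell (u := -u) hS hv.1
    fun y hy hact => by rw [inner_neg_left, hu' y hy hact, neg_zero]
  set ε := min ε₁ ε₂
  have hε : 0 < ε := lt_min hε₁ hε₂
  have hmem := hv.2 (h₁ ε hε.le (min_le_left _ _)) (h₂ ε hε.le (min_le_right _ _))
    ⟨1 / 2, 1 / 2, by norm_num, by norm_num, by norm_num, by module⟩
  have : ε • u = 0 := by simpa using hmem
  exact (smul_ne_zero hε.ne' hu0) this

/-- At an extreme point of the Voronoi cell there is a Delaunay simplex, which may be chosen to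
contain a prescribed linearly independent set of active points. -/
lemma exists_isDelaunayFrame_of_mem_extremePoints {S : Set (Space d)} (hS : IsLocFinite S)
    {v : Space d} (hv : v ∈ (voronoiCell S).extremePoints ℝ) {t : Set (Space d)}
    (ht : t ⊆ {y ∈ S | ‖v - y‖ = ‖v‖}) (hti : LinearIndepOn ℝ id t) :
    ∃ b, IsDelaunayFrame S b v ∧ t ⊆ range b := by
  obtain ⟨s, hs1, hts, hs2, hs3⟩ := exists_linearIndepOn_id_extension hti ht
  have hspan : ⊤ ≤ Submodule.span ℝ (range ((↑) : s → Space d)) := by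
    rw [Subtype.range_coe, ← span_active_eq_top hS hv]
    exact Submodule.span_le.2 hs2
  let B : Module.Basis s ℝ (Space d) := Module.Basis.mk hs3 hspan
  have hsf : Finite s := Module.Finite.finite_basis B
  have : Fintype s := Fintype.ofFinite s
  have hcard : Fintype.card s = d := by
    rw [← Module.finrank_eq_card_basis B]; simp
  let e : Fin d ≃ s := (Fintype.equivFinOfCardEq hcard).symm
  refine ⟨fun i => (e i : Space d), ⟨?_, fun i => (hs1 (e i).2).1, fun i => (hs1 (e i).2).2, hv.1⟩,
    fun y hy => ⟨e.symm ⟨y, hts hy⟩, by simp⟩⟩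
  exact LinearIndependent.comp hs3 e e.injective

/-- A linear functional attains its maximum over a compact convex set at an extreme point. -/
lemma exists_mem_extremePoints_inner_le {K : Set (Space d)} (hK : IsCompact K)
    (hne : K.Nonempty) (y : Space d) :
    ∃ v ∈ K.extremePoints ℝ, ∀ p ∈ K, inner ℝ p y ≤ inner ℝ v y := by
  let f : StrongDual ℝ (Space d) := innerSL ℝ y
  have hexp : IsExposed ℝ K (f.toExposed K) := ContinuousLinearMap.toExposed.isExposed
  obtain ⟨p, hp, hmax⟩ := hK.exists_isMaxOn hne f.continuous.continuousOn
  have hne' : (f.toExposed K).Nonempty := ⟨p, hp, fun q hq => hmax hq⟩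
  obtain ⟨v, hv⟩ := (hexp.isCompact hK).extremePoints_nonempty hne'
  refine ⟨v, hexp.isExtreme.extremePoints_subset_extremePoints hv, fun q hq => ?_⟩
  have := hv.1.2 q hq
  rw [real_inner_comm y q, real_inner_comm y v]
  exact this

/-- If `0` is not in the interior of the convex hull of `Y`, then `Y` is contained in a closed
half-space with `0` on its boundary. -/
lemma exists_forall_inner_nonpos_of_notMem_interior {Y : Set (Space d)} (hY : Y.Nonempty)
    (h : (0 : Space d) ∉ interior (convexHull ℝ Y)) :
    ∃ u : Space d, u ≠ 0 ∧ ∀ y ∈ Y, inner ℝ u y ≤ 0 := by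
  by_cases hint : (interior (convexHull ℝ Y)).Nonempty
  · obtain ⟨f, hf⟩ := geometric_hahn_banach_open_point (convex_convexHull ℝ Y).interior
      isOpen_interior h
    refine ⟨(InnerProductSpace.toDual ℝ (Space d)).symm f, ?_, fun y hy => ?_⟩
    · intro h0
      obtain ⟨a, ha⟩ := hint
      have h1 := hf a ha
      have : f = 0 := by simpa using h0
      simp [this] at h1
    · rw [InnerProductSpace.toDual_symm_apply]
      have hcl : y ∈ closure (interior (convexHull ℝ Y)) := by
        rw [(convex_convexHull ℝ Y).closure_interior_eq_closure_of_nonempty_interior hint]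
        exact subset_closure (subset_convexHull ℝ Y hy)
      have : closure (interior (convexHull ℝ Y)) ⊆ {z | f z ≤ 0} := by
        refine closure_minimal (fun z hz => ?_) (isClosed_le f.continuous continuous_const)
        have := hf z hz
        rw [map_zero] at this
        exact this.le
      exact this hcl
  · rw [interior_convexHull_nonempty_iff_affineSpan_eq_top] at hint
    obtain ⟨y₀, hy₀⟩ := hY
    have hdir : (affineSpan ℝ Y).direction ≠ ⊤ := fun h' => hint
      ((AffineSubspace.direction_eq_top_iff_of_nonempty ⟨y₀, subset_affineSpan ℝ Y hy₀⟩).1 h')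
    have hperp : (affineSpan ℝ Y).directionᗮ ≠ ⊥ := by
      rwa [Ne, Submodule.orthogonal_eq_bot_iff]
    obtain ⟨u, hu, hu0⟩ := Submodule.exists_mem_ne_zero_of_ne_bot hperp
    have hconst : ∀ y ∈ Y, inner ℝ u y = inner ℝ u y₀ := by
      intro y hy
      have : inner ℝ u (y - y₀) = 0 := Submodule.inner_left_of_mem_orthogonal
        (AffineSubspace.vsub_mem_direction (subset_affineSpan ℝ Y hy)
          (subset_affineSpan ℝ Y hy₀)) hu
      rw [inner_sub_right] at this
      linarith
    rcases le_total (inner ℝ u y₀) 0 with h0 | h0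
    · exact ⟨u, hu0, fun y hy => (hconst y hy).trans_le h0⟩
    · refine ⟨-u, neg_ne_zero.2 hu0, fun y hy => ?_⟩
      rw [inner_neg_left, hconst y hy]
      linarith

/-- Polarity: if `w` is in the cell, the half-space `⟨w, z⟩ ≤ M²` contains `Y`, hence its hull,
hence a ball of radius `ε`. Testing at `(ε / ‖w‖) • w` gives `‖w‖ ≤ M² / ε`. -/
lemma isBounded_voronoiCell_of_mem_interior {Y : Set (Space d)} (hY : Y.Finite)
    (h : (0 : Space d) ∈ interior (convexHull ℝ Y)) :
    Bornology.IsBounded (voronoiCell Y) := by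
  obtain ⟨M, hM⟩ := hY.isBounded.exists_norm_le
  obtain ⟨ε, hε, hball⟩ := Metric.nhds_basis_closedBall.mem_iff.1 (mem_interior_iff_mem_nhds.1 h)
  refine isBounded_iff_forall_norm_le.2 ⟨M ^ 2 / ε, fun w hw => ?_⟩
  by_cases hw0 : w = 0
  · subst hw0; simp; positivity
  have hwn : 0 < ‖w‖ := norm_pos_iff.2 hw0
  have hsub : convexHull ℝ Y ⊆ {z | inner ℝ w z ≤ M ^ 2} := by
    refine convexHull_min (fun y hy => ?_) ?_
    · have h1 := (norm_le_norm_sub_iff_two_inner_le w y).1 (hw y hy)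
      have h2 := pow_le_pow_left₀ (norm_nonneg y) (hM y hy) 2
      change inner ℝ w y ≤ M ^ 2
      nlinarith [sq_nonneg ‖y‖]
    · exact convex_halfSpace_le (innerSL ℝ w).isLinear _
  have hz : (ε / ‖w‖) • w ∈ Metric.closedBall (0 : Space d) ε := by
    rw [mem_closedBall_zero_iff, norm_smul, norm_div, norm_norm, Real.norm_of_nonneg hε.le]
    field_simp; rfl
  have h3 := hsub (hball hz)
  rw [mem_ofPred_eq, real_inner_smul_right, real_inner_self_eq_norm_sq] at h3
  rw [le_div_iff₀ hε]
  calc ‖w‖ * ε = ε / ‖w‖ * ‖w‖ ^ 2 := by field_simp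
    _ ≤ M ^ 2 := h3

lemma not_isBounded_voronoiCell {Y : Set (Space d)} {u : Space d} (hu0 : u ≠ 0)
    (hu : ∀ y ∈ Y, inner ℝ u y ≤ 0) : ¬ Bornology.IsBounded (voronoiCell Y) := by
  intro h
  obtain ⟨M, hM⟩ := isBounded_iff_forall_norm_le.1 h
  have hun : 0 < ‖u‖ := norm_pos_iff.2 hu0
  have hmem : ∀ t : ℝ, 0 ≤ t → t • u ∈ voronoiCell Y := by
    intro t ht y hy
    rw [norm_le_norm_sub_iff_two_inner_le, real_inner_smul_left]
    have := mul_nonpos_of_nonneg_of_nonpos ht (hu y hy)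
    nlinarith [sq_nonneg ‖y‖]
  have h1 := hM _ (hmem ((|M| + 1) / ‖u‖) (by positivity))
  rw [norm_smul, Real.norm_of_nonneg (by positivity)] at h1
  have : (|M| + 1) / ‖u‖ * ‖u‖ = |M| + 1 := by field_simp
  linarith [le_abs_self M]

lemma mem_interior_of_isBounded_voronoiCell {Y : Set (Space d)} (hY : Y.Nonempty)
    (h : Bornology.IsBounded (voronoiCell Y)) : (0 : Space d) ∈ interior (convexHull ℝ Y) := by
  by_contra hcon
  obtain ⟨u, hu0, hu⟩ := exists_forall_inner_nonpos_of_notMem_interior hY hcon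
  exact not_isBounded_voronoiCell hu0 hu h

/-- `S` is not contained in a closed half-space with `0` on its boundary. -/
def IsSurrounding (S : Set (Space d)) : Prop := ∀ u : Space d, u ≠ 0 → ∃ y ∈ S, 0 < inner ℝ u y

/-- Compactness of the unit sphere of directions extracts a finite subset of `S` that already
surrounds the origin, and the cell of `S` lies in the bounded cell of this subset. -/
lemma IsSurrounding.isCompact_voronoiCell {S : Set (Space d)} (hS : IsSurrounding S)
    (hd : 1 ≤ d) : IsCompact (voronoiCell S) := by
  have : NeZero d := ⟨by omega⟩
  refine Metric.isCompact_of_isClosed_isBounded (isClosed_voronoiCell S) ?_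
  obtain ⟨t, htS, htf, ht⟩ := (isCompact_sphere (0 : Space d) 1).elim_finite_subcover_image
    (b := S) (c := fun y => {u | 0 < inner ℝ u y})
    (fun y _ => isOpen_lt continuous_const (by fun_prop)) (fun u hu => by
      have hu0 : u ≠ 0 := by rintro rfl; simp at hu
      obtain ⟨y, hy, h⟩ := hS u hu0
      simp only [mem_iUnion]
      exact ⟨y, hy, h⟩)
  have htn : t.Nonempty := by
    have : (Metric.sphere (0 : Space d) 1).Nonempty := NormedSpace.sphere_nonempty.2 zero_le_one
    obtain ⟨u, hu⟩ := this
    have := ht hu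
    simp only [mem_iUnion] at this
    obtain ⟨y, hy, -⟩ := this
    exact ⟨y, hy⟩
  have hint : (0 : Space d) ∈ interior (convexHull ℝ t) := by
    by_contra hcon
    obtain ⟨u, hu0, hu⟩ := exists_forall_inner_nonpos_of_notMem_interior htn hcon
    have hun : 0 < ‖u‖ := norm_pos_iff.2 hu0
    have : ‖u‖⁻¹ • u ∈ Metric.sphere (0 : Space d) 1 := by
      rw [mem_sphere_zero_iff_norm, norm_smul, norm_inv, norm_norm, inv_mul_cancel₀ hun.ne']
    have := ht this
    simp only [mem_iUnion, mem_ofPred_eq, real_inner_smul_left] at this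
    obtain ⟨y, hy, h⟩ := this
    have := mul_nonpos_of_nonneg_of_nonpos (inv_nonneg.2 hun.le) (hu y hy)
    linarith
  exact (isBounded_voronoiCell_of_mem_interior htf hint).subset (voronoiCell_anti htS)

/-- An active point of the Voronoi cell is a Delaunay neighbour. -/
lemma mem_frameNeighbors_of_active {S : Set (Space d)} (hS : IsLocFinite S)
    (hK : IsCompact (voronoiCell S)) {y : Space d} (hy : y ∈ S) (hy0 : y ≠ 0) {p : Space d}
    (hp : p ∈ voronoiCell S) (hact : ‖p - y‖ = ‖p‖) : y ∈ frameNeighbors S := by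
  -- On the cell `⟨·, y⟩` is at most `‖y‖² / 2`, a value attained at `p`. Hence it is also attained
  -- at an extreme point, where `y` extends to a frame.
  obtain ⟨v, hv, hmax⟩ := exists_mem_extremePoints_inner_le hK ⟨p, hp⟩ y
  have h1 := (norm_sub_eq_norm_iff_two_inner_eq p y).1 hact
  have h2 := (norm_le_norm_sub_iff_two_inner_le v y).1 (hv.1 y hy)
  have h3 := hmax p hp
  have hvact : ‖v - y‖ = ‖v‖ := (norm_sub_eq_norm_iff_two_inner_eq v y).2 (by linarith)
  obtain ⟨b, hb, hyb⟩ := exists_isDelaunayFrame_of_mem_extremePoints hS hv (t := {y})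
    (by rintro _ rfl; exact ⟨hy, hvact⟩) ((linearIndepOn_singleton_iff ℝ).2 hy0)
  exact ⟨b, v, hb, hyb rfl⟩

/-- The Voronoi cell is determined by the Delaunay neighbours. -/
lemma voronoiCell_frameNeighbors {S : Set (Space d)} (hS : IsLocFinite S)
    (hK : IsCompact (voronoiCell S)) : voronoiCell (frameNeighbors S) = voronoiCell S := by
  refine Subset.antisymm (fun w hw => ?_) (voronoiCell_anti (frameNeighbors_subset S))
  by_contra hwS
  -- The segment from `0` to `w` leaves the cell at a last time `t < 1`. The constraint blocking it
  -- there comes from a neighbour `y` with `⟨w, y⟩ > 0`, and `w` itself would violate it.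
  let T : Set ℝ := {t | 0 ≤ t ∧ t • w ∈ voronoiCell S}
  have hconvex : ∀ t s : ℝ, 0 ≤ s → s ≤ t → t • w ∈ voronoiCell S → s • w ∈ voronoiCell S := by
    intro t s hs hst ht y hy
    have := (norm_le_norm_sub_iff_two_inner_le _ y).1 (ht y hy)
    rw [norm_le_norm_sub_iff_two_inner_le, real_inner_smul_left]
    rw [real_inner_smul_left] at this
    by_cases hi : 0 ≤ inner ℝ w y
    · nlinarith
    · nlinarith [sq_nonneg ‖y‖, mul_nonneg hs (neg_nonneg.2 (not_le.1 hi).le)]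
  have hT1 : ∀ t ∈ T, t ≤ 1 := by
    intro t ht
    by_contra hlt
    exact hwS (by simpa using hconvex t 1 zero_le_one (not_le.1 hlt).le ht.2)
  have hTc : IsCompact T := by
    refine Metric.isCompact_of_isClosed_isBounded ?_ ?_
    · exact (isClosed_le continuous_const continuous_id).inter
        ((isClosed_voronoiCell S).preimage (by fun_prop : Continuous fun t : ℝ => t • w))
    · exact (Metric.isBounded_Icc (0 : ℝ) 1).subset fun t ht => ⟨ht.1, hT1 t ht⟩
  obtain ⟨t, ht, htmax⟩ := hTc.exists_isMaxOn (f := id)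
    ⟨0, le_rfl, by simpa using zero_mem_voronoiCell S⟩ continuous_id.continuousOn
  have htlt : t < 1 := by
    refine lt_of_le_of_ne (hT1 t ht) ?_
    rintro rfl
    exact hwS (by simpa using ht.2)
  by_cases hex : ∀ y ∈ S, ‖t • w - y‖ = ‖t • w‖ → inner ℝ w y ≤ 0
  · obtain ⟨ε, hε, h⟩ := exists_pos_add_smul_mem_voronoiCell hS ht.2 hex
    have h1 := h ε hε.le le_rfl
    rw [← add_smul] at h1
    have : t + ε ≤ t := htmax ⟨by linarith [ht.1], h1⟩
    linarith
  · push Not at hex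
    obtain ⟨y, hy, hact, hpos⟩ := hex
    have hy0 : y ≠ 0 := by rintro rfl; simp at hpos
    have hn := mem_frameNeighbors_of_active hS hK hy hy0 ht.2 hact
    have h1 := (norm_le_norm_sub_iff_two_inner_le w y).1 (hw y hn)
    have h2 := (norm_sub_eq_norm_iff_two_inner_eq _ y).1 hact
    rw [real_inner_smul_left] at h2
    nlinarith

lemma Set.Finite.isLocFinite {Y : Set (Space d)} (hY : Y.Finite) : IsLocFinite Y :=
  fun _ => hY.subset inter_subset_left

/-- No circumsphere through `0` of linearly independent points of `S` contains a further point
of `S`. -/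
def IsGenericAt (S : Set (Space d)) : Prop :=
  ∀ (b : Fin d → Space d) (c : Space d), LinearIndependent ℝ b → (∀ i, b i ∈ S) →
    (∀ i, ‖c - b i‖ = ‖c‖) → ∀ y ∈ S, ‖c - y‖ = ‖c‖ → y = 0 ∨ y ∈ range b

/-- Emptiness turns frames of `Y` into frames of `S`. Conversely, for a frame of `S` with vertex `b
i` and centre `c`, maximise `⟨·, b i⟩` over the larger cell of `Y`. The maximiser is the centre of a
frame of `Y`, so by emptiness it lies in the cell of `S`; comparison with `c` puts `b i` on its
circumsphere, and genericity makes `b i` a vertex from `Y`. -/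
lemma eq_frameNeighbors_of_surrounding {S Y : Set (Space d)} (hgen : IsGenericAt S)
    (hYS : Y ⊆ S) (hYf : Y.Finite)
    (hY : Y ⊆ frameNeighbors Y) (hint : (0 : Space d) ∈ interior (convexHull ℝ Y))
    (hempty : ∀ b c, IsDelaunayFrame Y b c → c ∈ voronoiCell S) :
    Y = frameNeighbors S := by
  have hcompact : IsCompact (voronoiCell Y) := Metric.isCompact_of_isClosed_isBounded
    (isClosed_voronoiCell Y) (isBounded_voronoiCell_of_mem_interior hYf hint)
  refine Subset.antisymm (fun y hy => ?_) ?_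
  · obtain ⟨b, c, hb, hyb⟩ := hY hy
    exact ⟨b, c, ⟨hb.1, fun i => hYS (hb.2 i), hb.3, hempty b c hb⟩, hyb⟩
  · rintro _ ⟨b, c, hb, i, rfl⟩
    obtain ⟨v, hv, hmax⟩ := exists_mem_extremePoints_inner_le hcompact
      ⟨0, zero_mem_voronoiCell Y⟩ (b i)
    obtain ⟨b', hb', -⟩ := exists_isDelaunayFrame_of_mem_extremePoints hYf.isLocFinite hv
      (empty_subset _) (linearIndependent_empty ℝ _)
    have h1 := (norm_le_norm_sub_iff_two_inner_le v _).1 (hempty b' v hb' (b i) (hb.2 i))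
    have h2 := (norm_sub_eq_norm_iff_two_inner_eq c _).1 (hb.3 i)
    have h3 := hmax c (voronoiCell_anti hYS hb.4)
    have hact : ‖v - b i‖ = ‖v‖ := (norm_sub_eq_norm_iff_two_inner_eq v _).2 (by linarith)
    rcases hgen b' v hb'.1 (fun j => hYS (hb'.2 j)) hb'.3 (b i) (hb.2 i) hact with h0 | h0
    · exact absurd h0 (hb.1.ne_zero i)
    · obtain ⟨j, hj⟩ := h0
      exact hj ▸ hb'.2 j

/-- The Delaunay neighbours of `0` are characterised as the surrounding finite sets of points
whose flower is empty. -/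
theorem eq_frameNeighbors_iff {S Y : Set (Space d)} (hd : 1 ≤ d) (hS : IsLocFinite S)
    (hsur : IsSurrounding S) (hgen : IsGenericAt S) (hYS : Y ⊆ S) (hYf : Y.Finite)
    (hYn : Y.Nonempty) :
    (Y ⊆ frameNeighbors Y ∧ (0 : Space d) ∈ interior (convexHull ℝ Y) ∧
      ∀ b c, IsDelaunayFrame Y b c → c ∈ voronoiCell S) ↔ Y = frameNeighbors S := by
  refine ⟨fun ⟨h1, h2, h3⟩ => eq_frameNeighbors_of_surrounding hgen hYS hYf h1 h2 h3, ?_⟩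
  rintro rfl
  have hK := hsur.isCompact_voronoiCell hd
  have hcell := voronoiCell_frameNeighbors hS hK
  refine ⟨?_, mem_interior_of_isBounded_voronoiCell hYn (hcell ▸ hK.isBounded), ?_⟩
  · rintro y ⟨b, c, hb, hy⟩
    exact ⟨b, c, ⟨hb.1, fun i => ⟨b, c, hb, i, rfl⟩, hb.3, hcell ▸ hb.4⟩, hy⟩
  · intro b c hb
    exact hcell ▸ hb.4

end Geometry

/-! ### Delaunay simplices as frames seen from a vertex; dilations. -/

section Link

variable {d : ℕ}

lemma affineSpan_range_points_eq_top (s : Affine.Simplex ℝ (Space d) d) :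
    affineSpan ℝ (range s.points) = ⊤ := by
  rw [s.independent.affineSpan_eq_top_iff_card_eq_finrank_add_one]
  simp

/-- Taking the vertex `x` as origin, affine independence becomes linear independence, the
circumradius becomes `‖c‖`, and emptiness of the circumball says that `c` is in the Voronoi cell. -/
lemma exists_simplex_of_isDelaunayFrame {χ : Set (Space d)} {x : Space d} (hx : x ∈ χ)
    {b : Fin d → Space d} {c : Space d} (h : IsDelaunayFrame {w | x + w ∈ χ} b c) :
    ∃ s : Affine.Simplex ℝ (Space d) d, IsDelaunaySimplex χ s ∧
      range s.points = insert x (range fun i => x + b i) ∧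
      circumball s = Metric.ball (x + c) ‖c‖ := by
  let p : Fin (d + 1) → Space d := Fin.cons x fun i => x + b i
  have hind : AffineIndependent ℝ p := by
    rw [affineIndependent_iff_linearIndependent_vsub ℝ p 0,
      ← linearIndependent_equiv (finSuccAboveEquiv 0)]
    have heq : (fun i : {i : Fin (d + 1) // i ≠ 0} => p i -ᵥ p 0) ∘ finSuccAboveEquiv 0 = b := by
      ext1 i
      simp [p, finSuccAboveEquiv_apply]
    rw [heq]
    exact h.linearIndependent
  let s : Affine.Simplex ℝ (Space d) d := ⟨p, hind⟩
  have hdist : ∀ i, dist (s.points i) (x + c) = ‖c‖ := by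
    intro i
    refine Fin.cases ?_ (fun j => ?_) i
    · simp [s, p, dist_eq_norm]
    · have : x + b j - (x + c) = -(c - b j) := by abel
      simp only [s, p, Fin.cons_succ]
      rw [dist_eq_norm, this, norm_neg, h.dist_eq j]
  have hmem : x + c ∈ affineSpan ℝ (range s.points) := by
    rw [affineSpan_range_points_eq_top]; trivial
  have hball : circumball s = Metric.ball (x + c) ‖c‖ := by
    rw [circumball, ← s.eq_circumcenter_of_dist_eq hmem hdist,
      ← s.eq_circumradius_of_dist_eq hmem hdist]
  have hrange : range s.points = insert x (range fun i => x + b i) := by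
    simp only [s, p, Fin.range_cons]
  refine ⟨s, ⟨?_, ?_⟩, hrange, hball⟩
  · rw [hrange]
    rintro _ (rfl | ⟨i, rfl⟩)
    · exact hx
    · exact h.mem i
  · rw [hball, eq_empty_iff_forall_notMem]
    rintro w ⟨hw, hwχ⟩
    have h1 := h.center_mem (w - x) (by simpa using hwχ)
    rw [Metric.mem_ball, dist_eq_norm, ← norm_neg] at hw
    have : -(w - (x + c)) = c - (w - x) := by abel
    rw [this] at hw
    exact absurd h1 (not_le.2 hw)

lemma exists_isDelaunayFrame_of_simplex {χ : Set (Space d)} {x : Space d}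
    {s : Affine.Simplex ℝ (Space d) d} (hs : IsDelaunaySimplex χ s) (hx : x ∈ range s.points) :
    ∃ b c, IsDelaunayFrame {w | x + w ∈ χ} b c ∧
      range s.points = insert x (range fun i => x + b i) ∧
      circumball s = Metric.ball (x + c) ‖c‖ := by
  obtain ⟨j, rfl⟩ := hx
  set x := s.points j with hxdef
  let b : Fin d → Space d := fun i => s.points (j.succAbove i) - x
  let c := s.circumcenter - x
  have hc : ‖c‖ = s.circumradius := by
    rw [← s.dist_circumcenter_eq_circumradius j, dist_comm, dist_eq_norm]
  have hball : circumball s = Metric.ball (x + c) ‖c‖ := by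
    rw [circumball, hc, add_sub_cancel]
  refine ⟨b, c, ⟨?_, fun i => ?_, fun i => ?_, fun w hw => ?_⟩, ?_, hball⟩
  · have := (affineIndependent_iff_linearIndependent_vsub ℝ s.points j).1 s.independent
    rw [← linearIndependent_equiv (finSuccAboveEquiv j)] at this
    have heq : (fun i : {i : Fin (d + 1) // i ≠ j} => s.points i -ᵥ s.points j) ∘
        finSuccAboveEquiv j = b := by
      ext1 i
      simp [b, x, finSuccAboveEquiv_apply]
    rw [heq] at this
    exact this
  · exact hs.1 ⟨j.succAbove i, by simp [b]⟩
  · rw [hc, ← s.dist_circumcenter_eq_circumradius (j.succAbove i), dist_comm, dist_eq_norm]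
    simp [c, b]
  · by_contra hlt
    have : x + w ∈ circumball s ∩ χ := by
      refine ⟨?_, hw⟩
      rw [hball, Metric.mem_ball, dist_eq_norm, ← norm_neg]
      have : -(x + w - (x + c)) = c - w := by abel
      rw [this]
      exact not_le.1 hlt
    rw [hs.2] at this
    exact this
  · ext w
    constructor
    · rintro ⟨i, rfl⟩
      by_cases hij : i = j
      · left; rw [hij]
      · obtain ⟨i', rfl⟩ := Fin.exists_succAbove_eq hij
        right
        exact ⟨i', by simp [b]⟩
    · rintro (rfl | ⟨i, rfl⟩)
      · exact ⟨j, rfl⟩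
      · exact ⟨j.succAbove i, by simp [b]⟩

lemma delaunayGraph_adj_iff {χ : Set (Space d)} {x : Space d} (hx : x ∈ χ) (w : Space d) :
    (delaunayGraph χ).Adj x w ↔ w - x ∈ frameNeighbors {w | x + w ∈ χ} := by
  constructor
  · rintro ⟨hne, s, hs, hxs, hws⟩
    obtain ⟨b, c, h, hr, -⟩ := exists_isDelaunayFrame_of_simplex hs hxs
    rw [hr] at hws
    rcases hws with h' | ⟨i, rfl⟩
    · exact absurd h'.symm hne
    · exact ⟨b, c, h, i, by simp⟩
  · rintro hw
    have hw0 := frameNeighbors_ne_zero hw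
    obtain ⟨b, c, h, i, hi⟩ := hw
    obtain ⟨s, hs, hr, -⟩ := exists_simplex_of_isDelaunayFrame hx h
    refine ⟨fun h' => hw0 (by simp [h']), s, hs, ?_, ?_⟩
    · rw [hr]; exact mem_insert _ _
    · rw [hr]; right; exact ⟨i, by simp [hi]⟩

lemma delaunayDegree_eq {χ : Set (Space d)} {x : Space d} (hx : x ∈ χ) :
    delaunayDegree χ x = (frameNeighbors {w | x + w ∈ χ}).encard := by
  have : (delaunayGraph χ).neighborSet x = (fun w => x + w) '' frameNeighbors {w | x + w ∈ χ} := by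
    ext w
    rw [SimpleGraph.mem_neighborSet, delaunayGraph_adj_iff hx]
    constructor
    · intro h; exact ⟨_, h, by simp⟩
    · rintro ⟨v, hv, rfl⟩; simpa using hv
  rw [delaunayDegree, this, (add_right_injective x).encard_image]

lemma voronoiCell_insert_zero (S : Set (Space d)) : voronoiCell (insert 0 S) = voronoiCell S := by
  ext w; simp [voronoiCell]

/-- Frame vectors are nonzero and the point `0` imposes no constraint on the cell. This removes the
origin adjoined in the definitions of `C_k` and `Φ`. -/
lemma isDelaunayFrame_insert_zero (S : Set (Space d)) (b : Fin d → Space d) (c : Space d) :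
    IsDelaunayFrame (insert 0 S) b c ↔ IsDelaunayFrame S b c := by
  constructor
  · intro h
    exact ⟨h.1, fun i => (h.2 i).resolve_left (h.1.ne_zero i), h.3,
      voronoiCell_insert_zero S ▸ h.4⟩
  · intro h
    exact ⟨h.1, fun i => .inr (h.2 i), h.3, (voronoiCell_insert_zero S).symm ▸ h.4⟩

lemma delaunayGraph_insert_zero_adj_iff (S : Set (Space d)) (w : Space d) :
    (delaunayGraph (insert 0 S)).Adj 0 w ↔ w ∈ frameNeighbors S := by
  rw [delaunayGraph_adj_iff (mem_insert _ _), sub_zero]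
  simp only [zero_add, ofPred_mem_eq, frameNeighbors, isDelaunayFrame_insert_zero]

/-- The flower of `0`, in terms of Delaunay frames. -/
def frameFlower (S : Set (Space d)) : Set (Space d) :=
  {w | ∃ b c, IsDelaunayFrame S b c ∧ ‖c - w‖ < ‖c‖}

lemma voronoiFlower_insert_zero (S : Set (Space d)) :
    voronoiFlower (insert 0 S) 0 = frameFlower S := by
  ext w
  simp only [voronoiFlower, mem_iUnion, frameFlower, exists_prop]
  constructor
  · rintro ⟨s, hs, h0, hw⟩
    obtain ⟨b, c, h, -, hball⟩ := exists_isDelaunayFrame_of_simplex hs h0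
    simp only [zero_add, ofPred_mem_eq, isDelaunayFrame_insert_zero] at h hball
    refine ⟨b, c, h, ?_⟩
    rw [hball, Metric.mem_ball, dist_comm, dist_eq_norm] at hw
    exact hw
  · rintro ⟨b, c, h, hw⟩
    obtain ⟨s, hs, hr, hball⟩ := exists_simplex_of_isDelaunayFrame (χ := insert 0 S)
      (mem_insert _ _) (b := b) (c := c)
      (by simpa only [zero_add, ofPred_mem_eq, isDelaunayFrame_insert_zero] using h)
    refine ⟨s, hs, hr ▸ mem_insert _ _, ?_⟩
    rw [hball, zero_add, Metric.mem_ball, dist_comm, dist_eq_norm]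
    exact hw

lemma mem_convexPosition_iff {k : ℕ} (y : Fin k → Space d) :
    y ∈ convexPosition d k ↔ Function.Injective y ∧ range y ⊆ frameNeighbors (range y) ∧
      (0 : Space d) ∈ interior (convexHull ℝ (range y)) := by
  simp only [convexPosition, delaunayGraph_insert_zero_adj_iff, range_subset_iff]
  rfl

lemma phiContent_insert_zero (S : Set (Space d)) :
    phiContent (insert 0 S) 0 = volume (frameFlower S) := by
  rw [phiContent, voronoiFlower_insert_zero]

open scoped Pointwise

/-- Source of all homogeneity: through it `convexPosition` is a cone and the flower volume scales by
`r ^ d`. -/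
lemma isDelaunayFrame_smul_iff {r : ℝ} (hr : 0 < r) (S : Set (Space d)) (b : Fin d → Space d)
    (c : Space d) : IsDelaunayFrame (r • S) (r • b) (r • c) ↔ IsDelaunayFrame S b c := by
  have key : ∀ (r : ℝ), 0 < r → ∀ (S : Set (Space d)) (b : Fin d → Space d) (c : Space d),
      IsDelaunayFrame S b c → IsDelaunayFrame (r • S) (r • b) (r • c) := by
    intro r hr S b c h
    refine ⟨?_, fun i => smul_mem_smul_set (h.2 i), fun i => ?_, ?_⟩
    · exact h.1.units_smul (fun _ => Units.mk0 r hr.ne')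
    · rw [Pi.smul_apply, ← smul_sub, norm_smul, norm_smul, h.3 i]
    · rintro _ ⟨y, hy, rfl⟩
      simp only
      rw [← smul_sub, norm_smul, norm_smul]
      exact mul_le_mul_of_nonneg_left (h.4 y hy) (norm_nonneg r)
  refine ⟨fun h => ?_, key r hr S b c⟩
  have := key r⁻¹ (inv_pos.2 hr) _ _ _ h
  rwa [inv_smul_smul₀ hr.ne', inv_smul_smul₀ hr.ne', inv_smul_smul₀ hr.ne'] at this

lemma exists_frame_smul_iff {r : ℝ} (hr : 0 < r) (S : Set (Space d))
    (p : (Fin d → Space d) → Space d → Prop) :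
    (∃ b c, IsDelaunayFrame (r • S) b c ∧ p b c) ↔
      ∃ b c, IsDelaunayFrame S b c ∧ p (r • b) (r • c) := by
  constructor
  · rintro ⟨b, c, h, hp⟩
    refine ⟨r⁻¹ • b, r⁻¹ • c, ?_, ?_⟩
    · rwa [← isDelaunayFrame_smul_iff hr, smul_inv_smul₀ hr.ne', smul_inv_smul₀ hr.ne']
    · rwa [smul_inv_smul₀ hr.ne', smul_inv_smul₀ hr.ne']
  · rintro ⟨b, c, h, hp⟩
    exact ⟨r • b, r • c, (isDelaunayFrame_smul_iff hr S b c).2 h, hp⟩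

lemma frameNeighbors_smul {r : ℝ} (hr : 0 < r) (S : Set (Space d)) :
    frameNeighbors (r • S) = r • frameNeighbors S := by
  ext w
  rw [mem_smul_set_iff_inv_smul_mem₀ hr.ne']
  refine (exists_frame_smul_iff hr S fun b _ => w ∈ range b).trans ?_
  refine exists_congr fun b => exists_congr fun c => and_congr_right fun _ => ?_
  refine exists_congr fun i => ?_
  rw [Pi.smul_apply, eq_inv_smul_iff₀ hr.ne']

lemma frameFlower_smul {r : ℝ} (hr : 0 < r) (S : Set (Space d)) :
    frameFlower (r • S) = r • frameFlower S := by
  ext w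
  rw [mem_smul_set_iff_inv_smul_mem₀ hr.ne']
  refine (exists_frame_smul_iff hr S fun _ c => ‖c - w‖ < ‖c‖).trans ?_
  refine exists_congr fun b => exists_congr fun c => and_congr_right fun _ => ?_
  have : r • c - w = r • (c - r⁻¹ • w) := by rw [smul_sub, smul_inv_smul₀ hr.ne']
  rw [this, norm_smul, norm_smul, mul_lt_mul_iff_right₀ (by simpa using hr.ne')]

lemma range_smul_fun {k : ℕ} (r : ℝ) (y : Fin k → Space d) : range (r • y) = r • range y := by
  rw [← image_smul, ← range_comp]; rfl

lemma smul_mem_convexPosition_iff {k : ℕ} {r : ℝ} (hr : 0 < r) (y : Fin k → Space d) :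
    r • y ∈ convexPosition d k ↔ y ∈ convexPosition d k := by
  rw [mem_convexPosition_iff, mem_convexPosition_iff, range_smul_fun, frameNeighbors_smul hr,
    smul_set_subset_smul_set_iff₀ hr.ne', convexHull_smul, interior_smul₀ hr.ne',
    zero_mem_smul_set_iff hr.ne']
  refine and_congr_left fun _ => ⟨fun h => ?_, fun h => ?_⟩
  · intro i j hij; exact h (by simp [hij])
  · exact (smul_right_injective (Space d) hr.ne').comp h

lemma phiContent_smul {k : ℕ} {r : ℝ} (hr : 0 < r) (y : Fin k → Space d) :
    phiContent (insert 0 (range (r • y))) 0 =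
      ENNReal.ofReal (r ^ d) * phiContent (insert 0 (range y)) 0 := by
  rw [phiContent_insert_zero, phiContent_insert_zero, range_smul_fun, frameFlower_smul hr,
    Measure.addHaar_smul, finrank_euclideanSpace_fin, abs_of_pos (by positivity)]

end Link

/-! ### Factorial moments of the Poisson process from independence of counts. -/

section Poisson

lemma lintegral_natCast_poissonMeasure (r : ℝ≥0) :
    ∫⁻ n, (n : ℝ≥0∞) ∂(poissonMeasure r) = r := by
  rw [lintegral_countable', tsum_eq_zero_add' ENNReal.summable]
  have h : ∀ n : ℕ, ((n + 1 : ℕ) : ℝ≥0∞) * poissonMeasure r {n + 1} =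
      r * poissonMeasure r {n} := by
    intro n
    rw [poissonMeasure_singleton, poissonMeasure_singleton, ← ENNReal.ofReal_natCast,
      ← ENNReal.ofReal_coe_nnreal, ← ENNReal.ofReal_mul (by positivity),
      ← ENNReal.ofReal_mul (by positivity)]
    congr 1
    rw [Nat.factorial_succ]
    push_cast
    field_simp
    ring
  simp_rw [h]
  rw [ENNReal.tsum_mul_left]
  have h1 : ∑' n, poissonMeasure r {n} = 1 := by
    have := lintegral_countable' (μ := poissonMeasure r) fun _ => 1
    simpa using this.symm
  simp [h1]

/-- The probability that a unit Poisson process has no point in `U`. -/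
noncomputable def voidProb {d : ℕ} (U : Set (Space d)) : ℝ≥0∞ :=
  ENNReal.ofReal (Real.exp (-(volume U).toReal))

variable {d : ℕ} {Ω : Type*} [MeasurableSpace Ω] {P : Measure Ω}
  {η : Ω → Set (Space d)}

namespace IsUnitPoissonProcess

lemma measure_eq_empty (hη : IsUnitPoissonProcess P η) {U : Set (Space d)}
    (hU : MeasurableSet U) (hU' : volume U ≠ ∞) : P {ω | η ω ∩ U = ∅} = voidProb U := by
  have := hη.law_count U hU hU' 0
  rw [poissonMeasure_singleton] at this
  simp only [Nat.cast_zero, encard_eq_zero] at this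
  rw [this, voidProb]
  simp [ENNReal.coe_toNNReal_eq_toReal]

lemma measurableSet_eq_empty (hη : IsUnitPoissonProcess P η) {U : Set (Space d)}
    (hU : MeasurableSet U) : MeasurableSet {ω | η ω ∩ U = ∅} := by
  have := hη.measurable_count U hU (measurableSet_singleton 0)
  simpa only [preimage, mem_singleton_iff, encard_eq_zero] using this

/-- The law is prescribed only at finite values; the value `⊤` has the complementary mass, and both
measures are probabilities. -/
lemma map_count [IsProbabilityMeasure P] (hη : IsUnitPoissonProcess P η) {B : Set (Space d)}
    (hB : MeasurableSet B) (hB' : volume B ≠ ∞) :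
    P.map (fun ω => (η ω ∩ B).encard) =
      (poissonMeasure (volume B).toNNReal).map (Nat.cast : ℕ → ℕ∞) := by
  have hm := hη.measurable_count B hB
  have : IsProbabilityMeasure (P.map (fun ω => (η ω ∩ B).encard)) :=
    Measure.isProbabilityMeasure_map hm.aemeasurable
  have hn : ∀ n : ℕ, P.map (fun ω => (η ω ∩ B).encard) {(n : ℕ∞)} =
      (poissonMeasure (volume B).toNNReal).map (Nat.cast : ℕ → ℕ∞) {(n : ℕ∞)} := by
    intro n
    rw [Measure.map_apply hm (measurableSet_singleton _),
      Measure.map_apply .of_discrete (measurableSet_singleton _)]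
    have h1 : (Nat.cast : ℕ → ℕ∞) ⁻¹' {(n : ℕ∞)} = {n} := by ext; simp
    rw [h1, ← hη.law_count B hB hB' n]
    rfl
  have htop : ({⊤} : Set ℕ∞) = (⋃ n : ℕ, {(n : ℕ∞)})ᶜ := by
    ext x
    induction x using ENat.recTopCoe <;> simp
  have hdisj : Pairwise (Function.onFun Disjoint fun n : ℕ => ({(n : ℕ∞)} : Set ℕ∞)) := by
    intro i j hij
    simpa [Function.onFun] using hij
  refine Measure.ext_of_singleton fun a => ?_
  induction a using ENat.recTopCoe with
  | coe n => exact hn n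
  | top =>
    rw [htop, prob_compl_eq_one_sub .of_discrete, prob_compl_eq_one_sub .of_discrete,
      measure_iUnion hdisj fun _ => .of_discrete, measure_iUnion hdisj fun _ => .of_discrete]
    simp_rw [hn]

lemma lintegral_count [IsProbabilityMeasure P] (hη : IsUnitPoissonProcess P η) {B : Set (Space d)}
    (hB : MeasurableSet B) (hB' : volume B ≠ ∞) :
    ∫⁻ ω, ((η ω ∩ B).encard : ℝ≥0∞) ∂P = volume B := by
  have hm := hη.measurable_count B hB
  have h1 : ∫⁻ ω, ((η ω ∩ B).encard : ℝ≥0∞) ∂P =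
      ∫⁻ n : ℕ∞, (n : ℝ≥0∞) ∂(P.map fun ω => (η ω ∩ B).encard) :=
    (lintegral_map .of_discrete hm).symm
  rw [h1, hη.map_count hB hB', lintegral_map .of_discrete .of_discrete]
  simp only [ENat.toENNReal_coe]
  rw [lintegral_natCast_poissonMeasure, ENNReal.coe_toNNReal hB']

/-- Counts in disjoint sets multiply in expectation, on the event that a further disjoint set
is empty. -/
lemma setLIntegral_prod_count [IsProbabilityMeasure P] (hη : IsUnitPoissonProcess P η) {m : ℕ}
    {Q : Fin m → Set (Space d)} (hQ : ∀ i, MeasurableSet (Q i)) (hQv : ∀ i, volume (Q i) ≠ ∞)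
    (hQd : Pairwise fun i j => Disjoint (Q i) (Q j)) {U : Set (Space d)}
    (hU : MeasurableSet U) (hUv : volume U ≠ ∞) (hQU : ∀ i, Disjoint (Q i) U) :
    ∫⁻ ω in {ω | η ω ∩ U = ∅}, ∏ i, ((η ω ∩ Q i).encard : ℝ≥0∞) ∂P =
      voidProb U * ∏ i, volume (Q i) := by
  let R : Fin (m + 1) → Set (Space d) := Fin.cons U Q
  have hR : ∀ i, MeasurableSet (R i) := Fin.cases hU hQ
  have hRd : Pairwise fun i j => Disjoint (R i) (R j) := by
    intro i j
    refine Fin.cases ?_ (fun i' => ?_) i <;> refine Fin.cases ?_ (fun j' => ?_) j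
    · simp
    · intro _; exact (hQU j').symm
    · intro _; exact hQU i'
    · intro hij; exact hQd fun h => hij (congrArg Fin.succ h)
  have hind := hη.indep_count (m + 1) R hR hRd
  let g : Fin (m + 1) → ℕ∞ → ℝ≥0∞ :=
    Fin.cons (fun n => if n = 0 then 1 else 0) fun _ n => (n : ℝ≥0∞)
  have hind' := hind.comp g fun i => .of_discrete
  have hprod := lintegral_prod_eq_prod_lintegral_of_indepFun Finset.univ _ hind' fun i =>
    (Measurable.of_discrete (f := g i)).comp (hη.measurable_count _ (hR i))
  simp only [Fin.prod_univ_succ, Function.comp_apply] at hprod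
  have h0 : ∀ ω, g 0 ((η ω ∩ R 0).encard) = {ω | η ω ∩ U = ∅}.indicator 1 ω := by
    intro ω
    simp [g, R, indicator_apply]
  have hs : ∀ (i : Fin m) ω, g i.succ ((η ω ∩ R i.succ).encard) = ((η ω ∩ Q i).encard : ℝ≥0∞) :=
    fun i ω => rfl
  simp only [h0, hs] at hprod
  rw [lintegral_indicator_one (hη.measurableSet_eq_empty hU), hη.measure_eq_empty hU hUv] at hprod
  simp only [hη.lintegral_count (hQ _) (hQv _)] at hprod
  rw [← hprod, ← lintegral_indicator (hη.measurableSet_eq_empty hU)]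
  refine lintegral_congr fun ω => ?_
  by_cases h : η ω ∩ U = ∅ <;> simp [h]

lemma countable (hη : IsUnitPoissonProcess P η) (ω : Ω) : (η ω).Countable := by
  have : η ω = ⋃ n : ℕ, η ω ∩ Metric.closedBall 0 n := by
    rw [← inter_iUnion, Metric.iUnion_closedBall_nat, inter_univ]
  rw [this]
  exact countable_iUnion fun n => (hη.locallyFinite ω _ Metric.isBounded_closedBall).countable

end IsUnitPoissonProcess

/-- The counting measure of the `m`-tuples of points of `χ`. -/
noncomputable def tupleMeasure (m : ℕ) (χ : Set (Space d)) : Measure (Fin m → Space d) :=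
  Measure.count.restrict (univ.pi fun _ => χ)

lemma tupleMeasure_apply {m : ℕ} {χ : Set (Space d)} (hχ : χ.Countable)
    (A : Set (Fin m → Space d)) :
    tupleMeasure m χ A = ((A ∩ univ.pi fun _ => χ).encard : ℝ≥0∞) := by
  have hc : (univ.pi fun _ : Fin m => χ).Countable := countable_univ_pi fun _ => hχ
  rw [tupleMeasure, Measure.restrict_apply' hc.measurableSet, Measure.count_apply]
  exact (hc.mono inter_subset_right).measurableSet

lemma tupleMeasure_inter_pi {m : ℕ} {χ : Set (Space d)} {Q : Fin m → Set (Space d)}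
    (hQ : ∀ i, MeasurableSet (Q i)) (A : Set (Fin m → Space d)) (hA : MeasurableSet A) :
    tupleMeasure m χ (A ∩ univ.pi Q) =
      Measure.count.restrict (univ.pi fun i => χ ∩ Q i) A := by
  rw [tupleMeasure, Measure.restrict_apply (hA.inter (.univ_pi hQ)), Measure.restrict_apply hA,
    inter_assoc, ← pi_inter_distrib]
  simp_rw [inter_comm χ]

namespace IsUnitPoissonProcess

lemma tupleCell_apply_pi (hη : IsUnitPoissonProcess P η) {m : ℕ}
    {Q : Fin m → Set (Space d)} (ω : Ω)
    {s : Fin m → Set (Space d)} (hs : ∀ i, MeasurableSet (s i)) :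
    Measure.count.restrict (univ.pi fun i => η ω ∩ Q i) (univ.pi s) =
      ∏ i, ((η ω ∩ (Q i ∩ s i)).encard : ℝ≥0∞) := by
  rw [Measure.restrict_apply (.univ_pi hs), ← pi_inter_distrib, Measure.count_apply,
    encard_pi_eq_prod_encard]
  · rw [← ENat.toENNRealRingHom_apply, map_prod]
    refine Finset.prod_congr rfl fun i _ => ?_
    rw [inter_comm (s i), inter_assoc]
  · refine (countable_univ_pi fun i => (hη.countable ω).mono ?_).measurableSet
    exact fun x hx => hx.2.1

lemma isFiniteMeasure_tupleCell (hη : IsUnitPoissonProcess P η) {m : ℕ}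
    {Q : Fin m → Set (Space d)} (hQb : ∀ i, Bornology.IsBounded (Q i)) (ω : Ω) :
    IsFiniteMeasure (Measure.count.restrict (univ.pi fun i => η ω ∩ Q i)) := by
  refine ⟨?_⟩
  rw [Measure.restrict_apply_univ, Measure.count_apply_lt_top]
  exact Finite.pi fun i => hη.locallyFinite ω _ (hQb i)

/-- Bounded cells make these measures finite, so measurability need only be checked on boxes, where
the mass is a product of counts. -/
lemma measurable_tupleCell (hη : IsUnitPoissonProcess P η) {m : ℕ}
    {Q : Fin m → Set (Space d)} (hQ : ∀ i, MeasurableSet (Q i))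
    (hQb : ∀ i, Bornology.IsBounded (Q i)) :
    Measurable fun ω => Measure.count.restrict (univ.pi fun i => η ω ∩ Q i) := by
  have := hη.isFiniteMeasure_tupleCell hQb
  have hpi : ∀ s : Fin m → Set (Space d), (∀ i, MeasurableSet (s i)) →
      Measurable fun ω => Measure.count.restrict (univ.pi fun i => η ω ∩ Q i) (univ.pi s) := by
    intro s hs
    simp_rw [hη.tupleCell_apply_pi _ hs]
    exact Finset.measurable_prod _ fun i _ =>
      (Measurable.of_discrete (f := ENat.toENNReal)).comp
        (hη.measurable_count _ ((hQ i).inter (hs i)))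
  refine Measurable.measure_of_isPiSystem generateFrom_pi.symm isPiSystem_pi ?_ ?_
  · rintro _ ⟨s, hs, rfl⟩
    exact hpi s fun i => hs i (mem_univ i)
  · simpa using hpi (fun _ => univ) fun _ => .univ

/-- Factorial moments of the process in a product of disjoint sets, on the event that a further
disjoint set is empty. -/
lemma setLIntegral_tupleCell [IsProbabilityMeasure P] (hη : IsUnitPoissonProcess P η) {m : ℕ}
    {Q : Fin m → Set (Space d)} (hQ : ∀ i, MeasurableSet (Q i))
    (hQb : ∀ i, Bornology.IsBounded (Q i))
    (hQd : Pairwise fun i j => Disjoint (Q i) (Q j)) {U : Set (Space d)}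
    (hU : MeasurableSet U) (hUv : volume U ≠ ∞) (hQU : ∀ i, Disjoint (Q i) U)
    {A : Set (Fin m → Space d)} (hA : MeasurableSet A) :
    ∫⁻ ω in {ω | η ω ∩ U = ∅}, Measure.count.restrict (univ.pi fun i => η ω ∩ Q i) A ∂P =
      voidProb U * volume (A ∩ univ.pi Q) := by
  have hv0 : voidProb U ≠ 0 := by simp [voidProb, Real.exp_pos]
  have hvt : voidProb U ≠ ∞ := ENNReal.ofReal_ne_top
  have hm := hη.measurable_tupleCell hQ hQb
  let μ := (P.restrict {ω | η ω ∩ U = ∅}).bind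
    fun ω => Measure.count.restrict (univ.pi fun i => η ω ∩ Q i)
  have hμ : ∀ A, MeasurableSet A → μ A = ∫⁻ ω in {ω | η ω ∩ U = ∅},
      Measure.count.restrict (univ.pi fun i => η ω ∩ Q i) A ∂P :=
    fun A hA => Measure.bind_apply hA hm.aemeasurable
  -- Boxes determine a product measure, and on boxes the averaged measure is known by independence.
  -- The factor `voidProb U` is positive and can be divided out.
  have hpi : Measure.pi (fun i => (volume : Measure (Space d)).restrict (Q i)) =
      (voidProb U)⁻¹ • μ := by
    refine Measure.pi_eq fun s hs => ?_
    rw [Measure.smul_apply, hμ _ (.univ_pi hs)]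
    simp_rw [hη.tupleCell_apply_pi _ hs]
    rw [hη.setLIntegral_prod_count (fun i => (hQ i).inter (hs i))
      (fun i => ((measure_mono inter_subset_left).trans_lt (hQb i).measure_lt_top).ne)
      (fun i j hij => (hQd hij).mono inter_subset_left inter_subset_left) hU hUv
      (fun i => (hQU i).mono_left inter_subset_left), smul_eq_mul, ← mul_assoc,
      ENNReal.inv_mul_cancel hv0 hvt, one_mul]
    refine Finset.prod_congr rfl fun i _ => ?_
    rw [Measure.restrict_apply (hs i), inter_comm]
  rw [← hμ A hA, ← Measure.restrict_apply hA, volume_pi, Measure.restrict_pi_pi, hpi,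
    Measure.smul_apply, smul_eq_mul, ← mul_assoc, ENNReal.mul_inv_cancel hv0 hvt, one_mul]

end IsUnitPoissonProcess

/-- Injective tuples are covered by countably many products of disjoint bounded sets. -/
lemma exists_cells_cover (d m : ℕ) : ∃ Q : ℕ → Fin m → Set (Space d),
    (∀ j i, MeasurableSet (Q j i)) ∧ (∀ j i, Bornology.IsBounded (Q j i)) ∧
    (∀ j, Pairwise fun i i' => Disjoint (Q j i) (Q j i')) ∧
    {z : Fin m → Space d | Function.Injective z} ⊆ ⋃ j, univ.pi (Q j) := by
  classical
  let q := TopologicalSpace.denseSeq (Space d)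
  let D (p : ℕ × (Fin m → ℕ)) (i : Fin m) : Set (Space d) :=
    Metric.ball (q (p.2 i)) (1 / (p.1 + 1))
  -- Families of balls that overlap are discarded by making them empty.
  let Q' (p : ℕ × (Fin m → ℕ)) (i : Fin m) : Set (Space d) :=
    if Pairwise (fun i i' => Disjoint (D p i) (D p i')) then D p i else ∅
  obtain ⟨f, hf⟩ := exists_surjective_nat (ℕ × (Fin m → ℕ))
  refine ⟨fun j => Q' (f j), fun j i => ?_, fun j i => ?_, fun j i i' hii' => ?_, fun z hz => ?_⟩
  · simp only [Q']
    split_ifs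
    · exact Metric.isOpen_ball.measurableSet
    · exact .empty
  · simp only [Q']
    split_ifs
    · exact Metric.isBounded_ball
    · exact Bornology.isBounded_empty
  · simp only [Q']
    split_ifs with h
    · exact h hii'
    · exact disjoint_empty _
  -- With balls of radius `r` centred within `r` of the points, a separation above `4r` leaves
  -- centres more than `2r` apart, hence disjoint balls.
  · have hlim : ∀ᶠ n : ℕ in Filter.atTop, ∀ i i' : Fin m, i ≠ i' →
        4 * (1 / ((n : ℝ) + 1)) < dist (z i) (z i') := by
      refine Filter.eventually_all.2 fun i => Filter.eventually_all.2 fun i' => ?_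
      by_cases hii' : i = i'
      · simp [hii']
      · have h0 : 0 < dist (z i) (z i') := dist_pos.2 fun h => hii' (hz h)
        have := (tendsto_one_div_add_atTop_nhds_zero_nat (𝕜 := ℝ)).const_mul 4
        rw [mul_zero] at this
        filter_upwards [this.eventually (gt_mem_nhds h0)] with n hn _ using hn
    obtain ⟨n, hn⟩ := hlim.exists
    have hr : 0 < 1 / ((n : ℝ) + 1) := by positivity
    have hdense : ∀ i, ∃ j, dist (z i) (q j) < 1 / ((n : ℝ) + 1) := by
      intro i
      exact (TopologicalSpace.denseRange_denseSeq (Space d)).exists_dist_lt (z i) hr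
    choose J hJ using hdense
    obtain ⟨l, hl⟩ := hf (n, J)
    have hdisj : Pairwise fun i i' => Disjoint (D (n, J) i) (D (n, J) i') := by
      intro i i' hii'
      refine Metric.ball_disjoint_ball ?_
      have h1 := hn i i' hii'
      have h2 := dist_triangle4 (z i) (q (J i)) (q (J i')) (z i')
      have h3 := hJ i
      have h4 := hJ i'
      rw [dist_comm] at h4
      simp only
      linarith
    refine mem_iUnion.2 ⟨l, fun i _ => ?_⟩
    simp only [hl, Q', if_pos hdisj]
    exact hJ i

namespace IsUnitPoissonProcess

/-- Factorial moments of the process, on the event that a set `U` is empty. -/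
lemma setLIntegral_tupleMeasure [IsProbabilityMeasure P] (hη : IsUnitPoissonProcess P η) {m : ℕ}
    {A : Set (Fin m → Space d)} (hA : MeasurableSet A)
    (hinj : ∀ z ∈ A, Function.Injective z) {U : Set (Space d)}
    (hU : MeasurableSet U) (hUv : volume U ≠ ∞) (hAU : ∀ z ∈ A, ∀ i, z i ∉ U) :
    Measurable (fun ω => tupleMeasure m (η ω) A) ∧
      ∫⁻ ω in {ω | η ω ∩ U = ∅}, tupleMeasure m (η ω) A ∂P = voidProb U * volume A := by
  obtain ⟨Q', hQ', hQb', hQd', hcov⟩ := exists_cells_cover d m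
  -- Removing `U` makes the counts in the cells independent of the event that `U` is empty; the
  -- tuples of `A` avoid `U`, so none is lost.
  let Q (j : ℕ) (i : Fin m) : Set (Space d) := Q' j i \ U
  have hQ : ∀ j i, MeasurableSet (Q j i) := fun j i => (hQ' j i).diff hU
  have hQb : ∀ j i, Bornology.IsBounded (Q j i) := fun j i => (hQb' j i).subset sdiff_subset
  have hQd : ∀ j, Pairwise fun i i' => Disjoint (Q j i) (Q j i') :=
    fun j i i' h => (hQd' j h).mono sdiff_subset sdiff_subset
  let D : ℕ → Set (Fin m → Space d) := disjointed fun j => univ.pi (Q j)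
  have hD : ∀ j, MeasurableSet (D j) := .disjointed fun j => .univ_pi (hQ j)
  have hDQ : ∀ j, D j ⊆ univ.pi (Q j) := disjointed_subset _
  have hAc : A = ⋃ j, A ∩ D j := by
    rw [← inter_iUnion, iUnion_disjointed, eq_comm, inter_eq_left]
    intro z hz
    obtain ⟨j, hj⟩ := mem_iUnion.1 (hcov (hinj z hz))
    exact mem_iUnion.2 ⟨j, fun i hi => ⟨hj i hi, hAU z hz i⟩⟩
  have hdisj : Pairwise (Function.onFun Disjoint fun j => A ∩ D j) := fun i j hij =>
    (disjoint_disjointed _ hij).mono inter_subset_right inter_subset_right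
  have hmeas : ∀ j, MeasurableSet (A ∩ D j) := fun j => hA.inter (hD j)
  have hcell : ∀ ω j, tupleMeasure m (η ω) (A ∩ D j) =
      Measure.count.restrict (univ.pi fun i => η ω ∩ Q j i) (A ∩ D j) := by
    intro ω j
    rw [← tupleMeasure_inter_pi (hQ j) _ (hmeas j), inter_assoc, inter_eq_left.2 (hDQ j)]
  have hsum : ∀ ω, tupleMeasure m (η ω) A =
      ∑' j, Measure.count.restrict (univ.pi fun i => η ω ∩ Q j i) (A ∩ D j) := by
    intro ω
    conv_lhs => rw [hAc]
    rw [measure_iUnion hdisj hmeas]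
    simp_rw [hcell]
  have hmj : ∀ j, Measurable fun ω =>
      Measure.count.restrict (univ.pi fun i => η ω ∩ Q j i) (A ∩ D j) := fun j =>
    (Measure.measurable_coe (hmeas j)).comp (hη.measurable_tupleCell (hQ j) (hQb j))
  simp_rw [hsum]
  refine ⟨.tsum hmj, ?_⟩
  rw [lintegral_tsum fun j => (hmj j).aemeasurable]
  conv_rhs => rw [hAc, measure_iUnion hdisj hmeas, ← ENNReal.tsum_mul_left]
  refine tsum_congr fun j => ?_
  rw [hη.setLIntegral_tupleCell (hQ j) (hQb j) (hQd j) hU hUv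
    (fun i => disjoint_sdiff_left) (hmeas j), inter_assoc, inter_eq_left.2 (hDQ j)]

end IsUnitPoissonProcess

end Poisson

/-! ### Mecke formula for tuples with an empty associated set. -/

section VoidMecke

variable {d m : ℕ} {Ω : Type*} [MeasurableSpace Ω] {P : Measure Ω} {η : Ω → Set (Space d)}

/-- The tuples `z` all of whose sets `b i`, `i < n`, `z ∈ G i`, contain no point of `χ`. -/
def emptyTuples (G : ℕ → Set (Fin m → Space d)) (b : ℕ → Set (Space d)) (χ : Set (Space d))
    (n : ℕ) : Set (Fin m → Space d) := {z | ∀ i < n, z ∈ G i → χ ∩ b i = ∅}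

/-- The union of the sets `b i` with `i < n` and `z ∈ G i`. -/
def partialSection (G : ℕ → Set (Fin m → Space d)) (b : ℕ → Set (Space d))
    (n : ℕ) (z : Fin m → Space d) : Set (Space d) := {w | ∃ i < n, z ∈ G i ∧ w ∈ b i}

lemma mem_emptyTuples_succ {G : ℕ → Set (Fin m → Space d)} {b : ℕ → Set (Space d)}
    {χ : Set (Space d)} {n : ℕ} {z : Fin m → Space d} :
    z ∈ emptyTuples G b χ (n + 1) ↔ z ∈ emptyTuples G b χ n ∧ (z ∈ G n → χ ∩ b n = ∅) :=
  Nat.forall_lt_succ_right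

lemma mem_partialSection_succ {G : ℕ → Set (Fin m → Space d)} {b : ℕ → Set (Space d)}
    {n : ℕ} {z : Fin m → Space d} {w : Space d} :
    w ∈ partialSection G b (n + 1) z ↔ w ∈ partialSection G b n z ∨ (z ∈ G n ∧ w ∈ b n) :=
  Nat.exists_lt_succ_right

lemma measurableSet_emptyTuples {G : ℕ → Set (Fin m → Space d)} (hG : ∀ i, MeasurableSet (G i))
    (b : ℕ → Set (Space d)) (χ : Set (Space d)) (n : ℕ) :
    MeasurableSet (emptyTuples G b χ n) := by
  have : emptyTuples G b χ n = ⋂ i, {z | i < n → z ∈ G i → χ ∩ b i = ∅} := by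
    ext z; simp [emptyTuples]
  rw [this]
  refine .iInter fun i => ?_
  by_cases h1 : i < n
  · by_cases h2 : χ ∩ b i = ∅
    · simp [h2]
    · have : {z | i < n → z ∈ G i → χ ∩ b i = ∅} = (G i)ᶜ := by ext z; simp [h1, h2]
      rw [this]
      exact (hG i).compl
  · simp [h1]

lemma voidProb_le_one (U : Set (Space d)) : voidProb U ≤ 1 := by
  rw [voidProb, ENNReal.ofReal_le_one, Real.exp_le_one_iff]
  simp

lemma measurable_voidProb_of_prod {S : Set ((Fin m → Space d) × Space d)} (hS : MeasurableSet S) :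
    Measurable fun z => voidProb {w | (z, w) ∈ S} := by
  have : Measurable fun z => volume {w | (z, w) ∈ S} := measurable_measure_prodMk_left hS
  unfold voidProb
  fun_prop

lemma measurable_voidProb_partialSection {G : ℕ → Set (Fin m → Space d)}
    (hG : ∀ i, MeasurableSet (G i)) {b : ℕ → Set (Space d)} (hb : ∀ i, MeasurableSet (b i))
    (n : ℕ) : Measurable fun z => voidProb (partialSection G b n z) := by
  have hS : MeasurableSet (⋃ i, ⋃ _ : i < n, G i ×ˢ b i) :=
    .iUnion fun i => .iUnion fun _ => (hG i).prod (hb i)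
  convert measurable_voidProb_of_prod hS using 3
  ext w
  simp [partialSection, and_left_comm]

namespace IsUnitPoissonProcess

/-- Induction on the number of rectangles, splitting `A` along `G n`. Outside `G n` the last
condition is void; inside, it no longer depends on the tuple, so `b n` can be absorbed into `U`.
This is why `A` and `U` are general. -/
lemma setLIntegral_tupleMeasure_emptyTuples [IsProbabilityMeasure P]
    (hη : IsUnitPoissonProcess P η)
    {G : ℕ → Set (Fin m → Space d)} (hG : ∀ i, MeasurableSet (G i))
    {b : ℕ → Set (Space d)} (hb : ∀ i, MeasurableSet (b i)) (hbv : ∀ i, volume (b i) ≠ ∞) (n : ℕ)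
    {A : Set (Fin m → Space d)} (hA : MeasurableSet A)
    (hinj : ∀ z ∈ A, Function.Injective z) (hAG : ∀ z ∈ A, ∀ i, z ∈ G i → ∀ j, z j ∉ b i)
    {U : Set (Space d)} (hU : MeasurableSet U) (hUv : volume U ≠ ∞)
    (hAU : ∀ z ∈ A, ∀ i, z i ∉ U) :
    Measurable (fun ω => tupleMeasure m (η ω) (A ∩ emptyTuples G b (η ω) n)) ∧
      ∫⁻ ω in {ω | η ω ∩ U = ∅}, tupleMeasure m (η ω) (A ∩ emptyTuples G b (η ω) n) ∂P =
        ∫⁻ z in A, voidProb (U ∪ partialSection G b n z) := by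
  induction n generalizing A U with
  | zero =>
    have h1 : ∀ χ, emptyTuples G b χ 0 = univ := by intro χ; ext; simp [emptyTuples]
    have h2 : ∀ z, partialSection G b 0 z = ∅ := by intro z; ext; simp [partialSection]
    simp only [h1, h2, inter_univ, union_empty, lintegral_const, Measure.restrict_apply_univ]
    exact hη.setLIntegral_tupleMeasure hA hinj hU hUv hAU
  | succ n ih =>
    obtain ⟨m1, e1⟩ := ih (A := A \ G n) (hA.diff (hG n)) (fun z hz => hinj z hz.1)
      (fun z hz => hAG z hz.1) hU hUv (fun z hz => hAU z hz.1)
    obtain ⟨m2, e2⟩ := ih (A := A ∩ G n) (U := U ∪ b n) (hA.inter (hG n))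
      (fun z hz => hinj z hz.1) (fun z hz => hAG z hz.1) (hU.union (hb n))
      (measure_union_ne_top hUv (hbv n)) (fun z hz i h => h.elim (hAU z hz.1 i)
        (hAG z hz.1 n hz.2 i))
    have hev := hη.measurableSet_eq_empty (hb n)
    have hsplit : ∀ ω, tupleMeasure m (η ω) (A ∩ emptyTuples G b (η ω) (n + 1)) =
        {ω | η ω ∩ b n = ∅}.indicator
          (fun ω => tupleMeasure m (η ω) (A ∩ G n ∩ emptyTuples G b (η ω) n)) ω +
        tupleMeasure m (η ω) (A \ G n ∩ emptyTuples G b (η ω) n) := by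
      intro ω
      rw [← measure_inter_add_sdiff (A ∩ emptyTuples G b (η ω) (n + 1)) (hG n)]
      congr 1
      · by_cases h : η ω ∩ b n = ∅
        · rw [indicator_of_mem (show ω ∈ {ω | η ω ∩ b n = ∅} from h)]
          congr 1
          ext z
          simp only [mem_inter_iff, mem_emptyTuples_succ, h]
          tauto
        · rw [indicator_of_notMem (show ω ∉ {ω | η ω ∩ b n = ∅} from h)]
          convert measure_empty
          · ext z
            simp only [mem_inter_iff, mem_emptyTuples_succ, mem_empty_iff_false, iff_false]
            tauto
          · infer_instance
      · congr 1
        ext z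
        simp only [mem_inter_iff, mem_emptyTuples_succ, mem_sdiff]
        tauto
    simp_rw [hsplit]
    have m2' := m2.indicator hev
    refine ⟨m2'.add m1, ?_⟩
    rw [lintegral_add_left m2', e1, lintegral_indicator hev, Measure.restrict_restrict hev]
    have hset : {ω | η ω ∩ b n = ∅} ∩ {ω | η ω ∩ U = ∅} = {ω | η ω ∩ (U ∪ b n) = ∅} := by
      ext ω
      simp only [mem_inter_iff, mem_ofPred_eq, inter_union_distrib_left, union_empty_iff, and_comm]
    rw [hset, e2, ← lintegral_inter_add_sdiff _ A (hG n)]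
    congr 1
    · refine setLIntegral_congr_fun (hA.inter (hG n)) fun z hz => ?_
      congr 1
      ext w
      have := hz.2
      simp only [mem_union, mem_partialSection_succ]
      tauto
    · refine setLIntegral_congr_fun (hA.diff (hG n)) fun z hz => ?_
      congr 1
      ext w
      have := hz.2
      simp only [mem_union, mem_partialSection_succ]
      tauto

lemma tupleMeasure_lt_top (hη : IsUnitPoissonProcess P η) (ω : Ω) {A : Set (Fin m → Space d)}
    (hAb : Bornology.IsBounded A) : tupleMeasure m (η ω) A < ∞ := by
  obtain ⟨R, hR⟩ := isBounded_iff_forall_norm_le.1 hAb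
  rw [tupleMeasure_apply (hη.countable ω), ENat.toENNReal_lt_top, encard_lt_top_iff]
  refine (Finite.pi fun _ : Fin m =>
    hη.locallyFinite ω _ (Metric.isBounded_closedBall (x := 0) (r := R))).subset ?_
  rintro z ⟨hz, hzη⟩ i -
  exact ⟨hzη i (mem_univ i), by simpa using (norm_le_pi_norm z i).trans (hR z hz)⟩

variable {G : ℕ → Set (Fin m → Space d)} {b : ℕ → Set (Space d)}

/-- Limit over the number of rectangles. Boundedness of `A` provides dominating functions on both
sides: the number of all tuples in `A`, of mean `volume A`, and the constant `1` on `A`. -/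
lemma lintegral_tupleMeasure_of_isBounded [IsProbabilityMeasure P]
    (hη : IsUnitPoissonProcess P η) (hG : ∀ i, MeasurableSet (G i))
    (hb : ∀ i, MeasurableSet (b i)) (hbv : ∀ i, volume (b i) ≠ ∞)
    {A : Set (Fin m → Space d)} (hA : MeasurableSet A) (hAb : Bornology.IsBounded A)
    (hinj : ∀ z ∈ A, Function.Injective z) (hAG : ∀ z ∈ A, ∀ i, z ∈ G i → ∀ j, z j ∉ b i)
    (hfin : ∀ z ∈ A, volume {w | ∃ i, z ∈ G i ∧ w ∈ b i} ≠ ∞) :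
    Measurable (fun ω => tupleMeasure m (η ω) (A ∩ {z | ∀ i, z ∈ G i → η ω ∩ b i = ∅})) ∧
      ∫⁻ ω, tupleMeasure m (η ω) (A ∩ {z | ∀ i, z ∈ G i → η ω ∩ b i = ∅}) ∂P =
        ∫⁻ z in A, voidProb {w | ∃ i, z ∈ G i ∧ w ∈ b i} := by
  have hn := fun n => hη.setLIntegral_tupleMeasure_emptyTuples hG hb hbv n hA hinj hAG
    (U := ∅) .empty (by simp) (by simp)
  simp only [inter_empty, empty_union] at hn
  have huniv : {ω : Ω | True} = univ := by ext; simp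
  simp only [huniv, Measure.restrict_univ] at hn
  have h0 := hη.setLIntegral_tupleMeasure hA hinj (U := ∅) .empty (by simp) (by simp)
  simp only [inter_empty, huniv, Measure.restrict_univ] at h0
  have hv0 : voidProb (∅ : Set (Space d)) = 1 := by simp [voidProb]
  rw [hv0, one_mul] at h0
  have hlim : ∀ ω, Filter.Tendsto
      (fun n => tupleMeasure m (η ω) (A ∩ emptyTuples G b (η ω) n)) Filter.atTop
      (nhds (tupleMeasure m (η ω) (A ∩ {z | ∀ i, z ∈ G i → η ω ∩ b i = ∅}))) := by
    intro ω
    have hI : A ∩ {z | ∀ i, z ∈ G i → η ω ∩ b i = ∅} =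
        ⋂ n, A ∩ emptyTuples G b (η ω) n := by
      rw [← inter_iInter]
      congr 1
      ext z
      simp only [emptyTuples, mem_iInter, mem_ofPred_eq]
      exact ⟨fun h _ i _ => h i, fun h i => h (i + 1) i (Nat.lt_succ_self i)⟩
    rw [hI]
    refine tendsto_measure_iInter_atTop
      (fun n => (hA.inter (measurableSet_emptyTuples hG b _ n)).nullMeasurableSet) ?_
      ⟨0, ((measure_mono inter_subset_left).trans_lt (hη.tupleMeasure_lt_top ω hAb)).ne⟩
    intro n n' hnn'
    exact inter_subset_inter_right _ fun z hz i hi => hz i (hi.trans_le hnn')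
  refine ⟨measurable_of_tendsto_metrizable (fun n => (hn n).1) (tendsto_pi_nhds.2 hlim), ?_⟩
  have hAv : volume A ≠ ∞ := hAb.measure_lt_top.ne
  have hL := tendsto_lintegral_of_dominated_convergence (μ := P)
    (fun ω => tupleMeasure m (η ω) A) (fun n => (hn n).1)
    (fun n => .of_forall fun ω => measure_mono inter_subset_left) (by rwa [h0.2])
    (.of_forall hlim)
  have hR := tendsto_lintegral_of_dominated_convergence (μ := volume.restrict A)
    (F := fun n z => voidProb (partialSection G b n z))
    (f := fun z => voidProb {w | ∃ i, z ∈ G i ∧ w ∈ b i})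
    (fun _ => 1) (fun n => measurable_voidProb_partialSection hG hb n)
    (fun n => .of_forall fun z => voidProb_le_one _) (by simpa using hAv) ?_
  · simp_rw [fun n => (hn n).2] at hL
    exact tendsto_nhds_unique hL hR
  · refine (ae_restrict_iff' hA).2 (.of_forall fun z hz => ?_)
    have hU : {w | ∃ i, z ∈ G i ∧ w ∈ b i} = ⋃ n, partialSection G b n z := by
      ext w
      simp only [partialSection, mem_iUnion, mem_ofPred_eq]
      exact ⟨fun ⟨i, h⟩ => ⟨i + 1, i, Nat.lt_succ_self i, h⟩, fun ⟨_, i, _, h⟩ => ⟨i, h⟩⟩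
    have hmono : Monotone fun n => partialSection G b n z := by
      rintro n n' hnn' w ⟨i, hi, h⟩
      exact ⟨i, hi.trans_le hnn', h⟩
    have h1 := tendsto_measure_iUnion_atTop (μ := (volume : Measure (Space d))) hmono
    rw [← hU] at h1
    have h2 := (ENNReal.tendsto_toReal (hfin z hz)).comp h1
    exact ENNReal.tendsto_ofReal ((Real.continuous_exp.tendsto _).comp h2.neg)

/-- A Mecke formula: the expected number of tuples `z ∈ A` of points of the process whose set
`⋃ {b i | z ∈ G i}` contains no point of the process. -/
theorem lintegral_tupleMeasure [IsProbabilityMeasure P]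
    (hη : IsUnitPoissonProcess P η) (hG : ∀ i, MeasurableSet (G i))
    (hb : ∀ i, MeasurableSet (b i)) (hbv : ∀ i, volume (b i) ≠ ∞)
    {A : Set (Fin m → Space d)} (hA : MeasurableSet A)
    (hinj : ∀ z ∈ A, Function.Injective z) (hAG : ∀ z ∈ A, ∀ i, z ∈ G i → ∀ j, z j ∉ b i)
    (hfin : ∀ z ∈ A, volume {w | ∃ i, z ∈ G i ∧ w ∈ b i} ≠ ∞) :
    ∫⁻ ω, tupleMeasure m (η ω) (A ∩ {z | ∀ i, z ∈ G i → η ω ∩ b i = ∅}) ∂P =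
      ∫⁻ z in A, voidProb {w | ∃ i, z ∈ G i ∧ w ∈ b i} := by
  let AR (n : ℕ) : Set (Fin m → Space d) := A ∩ Metric.closedBall 0 n
  have hmonoA : Monotone AR := fun n n' h =>
    inter_subset_inter_right _ (Metric.closedBall_subset_closedBall (by exact_mod_cast h))
  have hAU : A = ⋃ n, AR n := by
    rw [← inter_iUnion, Metric.iUnion_closedBall_nat, inter_univ]
  have hn := fun n => hη.lintegral_tupleMeasure_of_isBounded hG hb hbv (A := AR n)
    (hA.inter Metric.isClosed_closedBall.measurableSet)
    (Metric.isBounded_closedBall.subset inter_subset_right) (fun z hz => hinj z hz.1)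
    (fun z hz => hAG z hz.1) (fun z hz => hfin z hz.1)
  have h1 : ∀ ω, tupleMeasure m (η ω) (A ∩ {z | ∀ i, z ∈ G i → η ω ∩ b i = ∅}) =
      ⨆ n, tupleMeasure m (η ω) (AR n ∩ {z | ∀ i, z ∈ G i → η ω ∩ b i = ∅}) := by
    intro ω
    conv_lhs => rw [hAU, iUnion_inter]
    exact Monotone.measure_iUnion fun n n' h => inter_subset_inter_left _ (hmonoA h)
  simp_rw [h1]
  rw [lintegral_iSup (fun n => (hn n).1) fun n n' h ω =>
    measure_mono (inter_subset_inter_left _ (hmonoA h))]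
  simp_rw [fun n => (hn n).2]
  conv_rhs => rw [hAU]
  exact (setLIntegral_iUnion_of_directed _ hmonoA.directed_le).symm

end IsUnitPoissonProcess

end VoidMecke

/-! ### Measurability of circumcentres, convex position and flowers. -/

section Center

variable {d : ℕ}

/-- The matrix whose rows are the vectors `b i`. -/
def rowMatrix (b : Fin d → Space d) : Matrix (Fin d) (Fin d) ℝ := Matrix.of fun i j => b i j

/-- The centre of the sphere through `0` and `d` linearly independent points. -/
noncomputable def frameCenter (b : Fin d → Space d) : Space d :=
  (rowMatrix b).det⁻¹ • WithLp.toLp 2 ((rowMatrix b).adjugate.mulVec fun i => ‖b i‖ ^ 2 / 2)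

lemma continuous_rowMatrix : Continuous (rowMatrix (d := d)) := by
  refine continuous_matrix fun i j => ?_
  simp only [rowMatrix, Matrix.of_apply]
  fun_prop

lemma measurable_frameCenter : Measurable (frameCenter (d := d)) := by
  have h1 : Measurable fun b : Fin d → Space d => (rowMatrix b).det⁻¹ :=
    continuous_rowMatrix.matrix_det.measurable.inv
  have h2 : Continuous fun b : Fin d → Space d =>
      WithLp.toLp 2 ((rowMatrix b).adjugate.mulVec fun i => ‖b i‖ ^ 2 / 2) :=
    (PiLp.continuous_toLp 2 _).comp
      (continuous_rowMatrix.matrix_adjugate.matrix_mulVec (by fun_prop))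
  exact h1.smul h2.measurable

lemma measurableSet_linearIndependent :
    MeasurableSet {b : Fin d → Space d | LinearIndependent ℝ b} :=
  isOpen_setOfPred_linearIndependent.measurableSet

lemma det_rowMatrix_ne_zero {b : Fin d → Space d} (hb : LinearIndependent ℝ b) :
    (rowMatrix b).det ≠ 0 := by
  have h : LinearIndependent ℝ (rowMatrix b).row :=
    hb.map' (WithLp.linearEquiv 2 ℝ (Fin d → ℝ)).toLinearMap (LinearEquiv.ker _)
  rw [Matrix.linearIndependent_rows_iff_isUnit, Matrix.isUnit_iff_isUnit_det] at h
  exact h.ne_zero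

lemma rowMatrix_mulVec (b : Fin d → Space d) (c : Space d) (i : Fin d) :
    (rowMatrix b).mulVec c.ofLp i = inner ℝ c (b i) := by
  simp [Matrix.mulVec, dotProduct, rowMatrix, PiLp.inner_apply]

/-- Equidistance is the linear system `2⟨c, b i⟩ = ‖b i‖²`, solved by Cramer's rule. The explicit
formula gives the measurability of the centre. -/
lemma forall_norm_sub_eq_iff {b : Fin d → Space d} (hb : LinearIndependent ℝ b) (c : Space d) :
    (∀ i, ‖c - b i‖ = ‖c‖) ↔ c = frameCenter b := by
  have hdet := det_rowMatrix_ne_zero hb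
  have h1 : (∀ i, ‖c - b i‖ = ‖c‖) ↔
      (rowMatrix b).mulVec c.ofLp = fun i => ‖b i‖ ^ 2 / 2 := by
    rw [funext_iff]
    refine forall_congr' fun i => ?_
    rw [norm_sub_eq_norm_iff_two_inner_eq, rowMatrix_mulVec]
    constructor <;> intro h <;> linarith
  rw [h1]
  constructor
  · intro h
    rw [frameCenter, ← h, Matrix.mulVec_mulVec, Matrix.adjugate_mul, Matrix.smul_mulVec,
      Matrix.one_mulVec, WithLp.toLp_smul, smul_smul, inv_mul_cancel₀ hdet, one_smul]
  · rintro rfl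
    rw [frameCenter, WithLp.ofLp_smul, Matrix.mulVec_smul, Matrix.mulVec_mulVec,
      Matrix.mul_adjugate, Matrix.smul_mulVec, Matrix.one_mulVec, smul_smul,
      inv_mul_cancel₀ hdet, one_smul]

/-- The tuples for which the subfamily indexed by `J` is a Delaunay frame. -/
def frameTuples (k : ℕ) (J : Fin d → Fin k) : Set (Fin k → Space d) :=
  {y | LinearIndependent ℝ (y ∘ J) ∧
    ∀ l, ‖frameCenter (y ∘ J)‖ ≤ ‖frameCenter (y ∘ J) - y l‖}

lemma measurable_frameCenter_comp {k : ℕ} (J : Fin d → Fin k) :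
    Measurable fun y : Fin k → Space d => frameCenter (y ∘ J) :=
  measurable_frameCenter.comp (measurable_pi_lambda _ fun i => measurable_pi_apply (J i))

lemma measurableSet_frameTuples (k : ℕ) (J : Fin d → Fin k) :
    MeasurableSet (frameTuples k J) := by
  have hc := measurable_frameCenter_comp J
  refine MeasurableSet.inter ?_ ?_
  · exact measurableSet_linearIndependent.preimage
      (measurable_pi_lambda (fun y : Fin k → Space d => y ∘ J) fun i => measurable_pi_apply (J i))
  · have : {y : Fin k → Space d | ∀ l, ‖frameCenter (y ∘ J)‖ ≤ ‖frameCenter (y ∘ J) - y l‖} =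
        ⋂ l, {y | ‖frameCenter (y ∘ J)‖ ≤ ‖frameCenter (y ∘ J) - y l‖} := by ext; simp
    change MeasurableSet {y : Fin k → Space d |
      ∀ l, ‖frameCenter (y ∘ J)‖ ≤ ‖frameCenter (y ∘ J) - y l‖}
    rw [this]
    exact .iInter fun l => measurableSet_le hc.norm (hc.sub (measurable_pi_apply l)).norm

/-- The centre is determined by the vertices, so a quantifier over frames reduces to a finite one
over index maps `J`, which is suitable for measurability. -/
lemma exists_isDelaunayFrame_range_iff {k : ℕ} (y : Fin k → Space d)
    (p : (Fin d → Space d) → Space d → Prop) :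
    (∃ b c, IsDelaunayFrame (range y) b c ∧ p b c) ↔
      ∃ J : Fin d → Fin k, y ∈ frameTuples k J ∧ p (y ∘ J) (frameCenter (y ∘ J)) := by
  constructor
  · rintro ⟨b, c, h, hp⟩
    choose J hJ using h.mem
    obtain rfl : y ∘ J = b := funext hJ
    obtain rfl := (forall_norm_sub_eq_iff h.1 c).1 h.3
    exact ⟨J, ⟨h.1, fun l => h.4 _ ⟨l, rfl⟩⟩, hp⟩
  · rintro ⟨J, ⟨h1, h2⟩, hp⟩
    refine ⟨_, _, ⟨h1, fun i => ⟨J i, rfl⟩, (forall_norm_sub_eq_iff h1 _).2 rfl, ?_⟩, hp⟩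
    rintro _ ⟨l, rfl⟩
    exact h2 l

lemma mem_frameFlower_range_iff {k : ℕ} (y : Fin k → Space d) (w : Space d) :
    w ∈ frameFlower (range y) ↔ ∃ J : Fin d → Fin k, y ∈ frameTuples k J ∧
      dist w (frameCenter (y ∘ J)) < ‖frameCenter (y ∘ J)‖ := by
  simp_rw [dist_comm w, dist_eq_norm]
  exact exists_isDelaunayFrame_range_iff y fun _ c => ‖c - w‖ < ‖c‖

lemma volume_frameFlower_range_ne_top {k : ℕ} (y : Fin k → Space d) :
    volume (frameFlower (range y)) ≠ ∞ := by
  refine ((measure_mono (t := ⋃ J : Fin d → Fin k, Metric.ball (frameCenter (y ∘ J))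
    ‖frameCenter (y ∘ J)‖) fun w hw => ?_).trans_lt ?_).ne
  · obtain ⟨J, -, hJ⟩ := (mem_frameFlower_range_iff y w).1 hw
    exact mem_iUnion.2 ⟨J, hJ⟩
  · exact (Bornology.isBounded_iUnion.2 fun J => Metric.isBounded_ball).measure_lt_top

lemma measurableSet_injective_tuples (k : ℕ) :
    MeasurableSet {y : Fin k → Space d | Function.Injective y} := by
  have : {y : Fin k → Space d | Function.Injective y} =
      ⋂ i, ⋂ j, {y | y i = y j → i = j} := by ext; simp [Function.Injective]
  rw [this]
  refine .iInter fun i => .iInter fun j => ?_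
  by_cases h : i = j
  · simp [h]
  · have : {y : Fin k → Space d | y i = y j → i = j} = {y | y i = y j}ᶜ := by ext; simp [h]
    rw [this]
    exact (measurableSet_eq_fun (measurable_pi_apply i) (measurable_pi_apply j)).compl

lemma zero_notMem_interior_convexHull_iff {Y : Set (Space d)} (hY : Y.Finite)
    (hYn : Y.Nonempty) : (0 : Space d) ∉ interior (convexHull ℝ Y) ↔
      ∃ u : Space d, ‖u‖ = 1 ∧ ∀ y ∈ Y, inner ℝ u y ≤ 0 := by
  constructor
  · intro h
    obtain ⟨u, hu0, hu⟩ := exists_forall_inner_nonpos_of_notMem_interior hYn h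
    have hun : 0 < ‖u‖ := norm_pos_iff.2 hu0
    refine ⟨‖u‖⁻¹ • u, ?_, fun y hy => ?_⟩
    · rw [norm_smul, norm_inv, norm_norm, inv_mul_cancel₀ hun.ne']
    · rw [real_inner_smul_left]
      exact mul_nonpos_of_nonneg_of_nonpos (inv_nonneg.2 hun.le) (hu y hy)
  · rintro ⟨u, hu1, hu⟩ h
    exact not_isBounded_voronoiCell (by rintro rfl; simp at hu1) hu
      (isBounded_voronoiCell_of_mem_interior hY h)

/-- The complement is the projection, along the compact unit sphere, of the closed set of pairs `(u,
y)` with `⟨u, y l⟩ ≤ 0` for all `l`; hence it is closed. -/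
lemma measurableSet_zero_mem_interior {k : ℕ} (hk : 1 ≤ k) :
    MeasurableSet {y : Fin k → Space d | (0 : Space d) ∈ interior (convexHull ℝ (range y))} := by
  have : Nonempty (Fin k) := ⟨⟨0, hk⟩⟩
  refine MeasurableSet.of_compl (IsClosed.measurableSet ?_)
  let C : Set (Metric.sphere (0 : Space d) 1 × (Fin k → Space d)) :=
    {p | ∀ l, inner ℝ (p.1 : Space d) (p.2 l) ≤ 0}
  have hC : IsClosed C := by
    have : C = ⋂ l, {p | inner ℝ (p.1 : Space d) (p.2 l) ≤ 0} := by ext; simp [C]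
    rw [this]
    exact isClosed_iInter fun l => isClosed_le (by fun_prop) continuous_const
  have : CompactSpace (Metric.sphere (0 : Space d) 1) :=
    isCompact_iff_compactSpace.1 (isCompact_sphere 0 1)
  convert isClosedMap_snd_of_compactSpace C hC
  ext y
  rw [mem_compl_iff, mem_ofPred_eq,
    zero_notMem_interior_convexHull_iff (finite_range y) (range_nonempty y)]
  simp [C]

lemma measurableSet_convexPosition {k : ℕ} (hk : 1 ≤ k) :
    MeasurableSet (convexPosition d k) := by
  have : convexPosition d k = {y | Function.Injective y} ∩
      ((⋂ l : Fin k, ⋃ J : Fin d → Fin k, frameTuples k J ∩ ⋃ i, {y | y (J i) = y l}) ∩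
      {y | (0 : Space d) ∈ interior (convexHull ℝ (range y))}) := by
    ext y
    rw [mem_convexPosition_iff, range_subset_iff]
    refine and_congr_right fun _ => and_congr_left fun _ => ?_
    rw [mem_iInter]
    refine forall_congr' fun l => ?_
    refine (exists_isDelaunayFrame_range_iff y fun b _ => y l ∈ range b).trans ?_
    simp
  rw [this]
  refine (measurableSet_injective_tuples k).inter (.inter (.iInter fun l => .iUnion fun J =>
    (measurableSet_frameTuples k J).inter (.iUnion fun i => ?_))
    (measurableSet_zero_mem_interior hk))
  exact measurableSet_eq_fun (measurable_pi_apply _) (measurable_pi_apply _)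

/-- A measurable family of finite unions of balls is a countable union of rectangles. -/
lemma exists_rectangles {Z ι : Type*} [MeasurableSpace Z] [Countable ι] [Nonempty ι]
    {D : ι → Set Z} (hD : ∀ J, MeasurableSet (D J)) {C : ι → Z → Space d}
    (hC : ∀ J, Measurable (C J)) {R : ι → Z → ℝ} (hR : ∀ J, Measurable (R J)) :
    ∃ (G : ℕ → Set Z) (b : ℕ → Set (Space d)), (∀ i, MeasurableSet (G i)) ∧
      (∀ i, MeasurableSet (b i)) ∧ (∀ i, volume (b i) ≠ ∞) ∧
      ∀ z, {w | ∃ i, z ∈ G i ∧ w ∈ b i} = {w | ∃ J, z ∈ D J ∧ dist w (C J z) < R J z} := by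
  let q := TopologicalSpace.denseSeq (Space d)
  obtain ⟨f, hf⟩ := exists_surjective_nat (ι × ℕ × ℕ)
  let G' (p : ι × ℕ × ℕ) : Set Z :=
    D p.1 ∩ {z | dist (q p.2.1) (C p.1 z) + 1 / ((p.2.2 : ℝ) + 1) ≤ R p.1 z}
  let b' (p : ι × ℕ × ℕ) : Set (Space d) := Metric.ball (q p.2.1) (1 / ((p.2.2 : ℝ) + 1))
  refine ⟨fun i => G' (f i), fun i => b' (f i), fun i => ?_,
    fun i => Metric.isOpen_ball.measurableSet, fun i => Metric.isBounded_ball.measure_lt_top.ne, fun z => ?_⟩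
  · exact (hD _).inter (measurableSet_le ((measurable_const.dist (hC _)).add_const _) (hR _))
  · ext w
    constructor
    · rintro ⟨i, ⟨h1, h2⟩, h3⟩
      refine ⟨_, h1, ?_⟩
      have h4 := dist_triangle w (q (f i).2.1) (C (f i).1 z)
      have h3' : dist w (q (f i).2.1) < 1 / (((f i).2.2 : ℝ) + 1) := h3
      have h2' : dist (q (f i).2.1) (C (f i).1 z) + 1 / (((f i).2.2 : ℝ) + 1) ≤ R (f i).1 z := h2
      linarith
    · rintro ⟨J, h1, h2⟩
      -- Half of the slack, because the small radius is spent twice: once moving from `w` to the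
      -- dense point, once for the small ball to fit inside.
      obtain ⟨n, hn⟩ := exists_nat_one_div_lt (half_pos (sub_pos.2 h2))
      obtain ⟨j, hj⟩ := (TopologicalSpace.denseRange_denseSeq (Space d)).exists_dist_lt w
        (ε := 1 / ((n : ℝ) + 1)) (by positivity)
      obtain ⟨i, hi⟩ := hf (J, j, n)
      refine ⟨i, ?_, ?_⟩
      · simp only [hi]
        refine ⟨h1, ?_⟩
        have h4 := dist_triangle_left (q j) (C J z) w
        change dist (q j) (C J z) + 1 / ((n : ℝ) + 1) ≤ R J z
        linarith
      · simp only [hi]; exact hj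

end Center

/-! ### Almost sure surrounding and general position. -/

section AlmostSure

variable {d : ℕ} {Ω : Type*} [MeasurableSpace Ω] {P : Measure Ω} {η : Ω → Set (Space d)}

lemma tendsto_voidProb_ball (hd : 1 ≤ d) {r : ℝ} (hr : 0 < r) (c : ℕ → Space d) :
    Filter.Tendsto (fun n : ℕ => voidProb (Metric.ball (c n) (n * r))) Filter.atTop (nhds 0) := by
  have : Nontrivial (Space d) := Module.nontrivial_of_finrank_pos (R := ℝ) (by simp; omega)
  have hκ : 0 < (volume (Metric.ball (0 : Space d) 1)).toReal :=
    ENNReal.toReal_pos (Metric.measure_ball_pos _ _ one_pos).ne' measure_ball_lt_top.ne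
  have h1 : ∀ n : ℕ, voidProb (Metric.ball (c n) (n * r)) = ENNReal.ofReal
      (Real.exp (-((n * r) ^ d * (volume (Metric.ball (0 : Space d) 1)).toReal))) := by
    intro n
    rw [voidProb, Measure.addHaar_ball _ _ (by positivity), ENNReal.toReal_mul,
      ENNReal.toReal_ofReal (by positivity), finrank_euclideanSpace_fin]
  simp_rw [h1]
  rw [← ENNReal.ofReal_zero]
  refine ENNReal.tendsto_ofReal (Real.tendsto_exp_neg_atTop_nhds_zero.comp ?_)
  refine Filter.Tendsto.atTop_mul_const hκ ?_
  exact (Filter.tendsto_pow_atTop (by omega)).comp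
    (tendsto_natCast_atTop_atTop.atTop_mul_const hr)

namespace IsUnitPoissonProcess

/-- Almost surely, every point sees points of the process in all half-spaces. -/
lemma ae_isSurrounding (hη : IsUnitPoissonProcess P η) (hd : 1 ≤ d) :
    ∀ᵐ ω ∂P, ∀ x, IsSurrounding {w | x + w ∈ η ω} := by
  let q := TopologicalSpace.denseSeq (Space d)
  have h1 : ∀ᵐ ω ∂P, ∀ j N : ℕ, q j ≠ 0 →
      ∃ n ≥ N, (η ω ∩ Metric.ball ((n : ℝ) • q j) (n * (‖q j‖ / 4))).Nonempty := by
    refine ae_all_iff.2 fun j => ae_all_iff.2 fun N => ?_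
    by_cases hj : q j = 0
    · simp [hj]
    have hr : 0 < ‖q j‖ / 4 := by have := norm_pos_iff.2 hj; positivity
    have hlim := tendsto_voidProb_ball hd hr fun n => (n : ℝ) • q j
    rw [ae_iff]
    -- If no ball with index at least `N` is hit, then each of them is empty, and a single void
    -- probability is already arbitrarily small.
    refine le_antisymm (ge_of_tendsto hlim ?_) zero_le
    filter_upwards [Filter.eventually_ge_atTop N] with n hn
    rw [← hη.measure_eq_empty Metric.isOpen_ball.measurableSet measure_ball_lt_top.ne]
    refine measure_mono fun ω hω => ?_
    by_contra hne
    exact hω fun _ => ⟨n, hn, nonempty_iff_ne_empty.2 hne⟩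
  filter_upwards [h1] with ω hω x u hu0
  have hun : 0 < ‖u‖ := norm_pos_iff.2 hu0
  obtain ⟨j, hj⟩ := (TopologicalSpace.denseRange_denseSeq (Space d)).exists_dist_lt u
    (ε := ‖u‖ / 8) (by positivity)
  change dist u (q j) < ‖u‖ / 8 at hj
  rw [dist_eq_norm] at hj
  have hq1 : ‖q j‖ ≤ 9 / 8 * ‖u‖ := by
    have := norm_sub_norm_le (q j) u
    rw [norm_sub_rev] at this
    linarith
  have hq0 : q j ≠ 0 := by
    intro h
    rw [h, sub_zero] at hj
    linarith
  -- A point `y` in the `n`-th ball has `⟨u, y⟩ ≥ (1 - 1/8 - 9/32) n ‖u‖²`, which is at least `n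
  -- ‖u‖² / 2`. This choice of `N` makes the latter exceed `⟨u, x⟩`.
  obtain ⟨N, hN⟩ := exists_nat_gt (2 * inner ℝ u x / ‖u‖ ^ 2)
  obtain ⟨n, hn, y, hy, hyb⟩ := hω j N hq0
  refine ⟨y - x, by simpa using hy, ?_⟩
  rw [inner_sub_right]
  rw [Metric.mem_ball, dist_eq_norm] at hyb
  have hn0 : (0 : ℝ) ≤ n := Nat.cast_nonneg n
  have e1 : inner ℝ u y = inner ℝ u (y - (n : ℝ) • q j) + n * (‖u‖ ^ 2 - inner ℝ u (u - q j)) := by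
    rw [inner_sub_right, inner_sub_right, real_inner_smul_right, real_inner_self_eq_norm_sq]
    ring
  have e2 : -(‖u‖ * (n * (‖q j‖ / 4))) ≤ inner ℝ u (y - (n : ℝ) • q j) := by
    have h2 := neg_le_of_abs_le (abs_real_inner_le_norm u (y - (n : ℝ) • q j))
    have h3 := mul_le_mul_of_nonneg_left hyb.le hun.le
    linarith
  have e3 : inner ℝ u (u - q j) ≤ ‖u‖ * (‖u‖ / 8) :=
    (real_inner_le_norm _ _).trans (mul_le_mul_of_nonneg_left hj.le hun.le)
  have e4 : ‖u‖ * (n * (‖q j‖ / 4)) ≤ n * (9 / 32 * ‖u‖ ^ 2) := by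
    have := mul_le_mul_of_nonneg_left hq1 (mul_nonneg hn0 hun.le)
    nlinarith
  have e5 : n * inner ℝ u (u - q j) ≤ n * (‖u‖ ^ 2 / 8) := by
    refine mul_le_mul_of_nonneg_left ?_ hn0
    linarith [e3, (by ring : ‖u‖ * (‖u‖ / 8) = ‖u‖ ^ 2 / 8)]
  have e6 : 2 * inner ℝ u x < n * ‖u‖ ^ 2 := by
    rw [div_lt_iff₀ (by positivity)] at hN
    refine hN.trans_le (mul_le_mul_of_nonneg_right (by exact_mod_cast hn) (by positivity))
  have e7 : 0 ≤ n * ‖u‖ ^ 2 := by positivity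
  have e8 : inner ℝ u y ≥ n * ‖u‖ ^ 2 - n * (‖u‖ ^ 2 / 8) - n * (9 / 32 * ‖u‖ ^ 2) := by
    rw [e1, mul_sub]; linarith
  linarith

end IsUnitPoissonProcess

/-- The injective tuples whose first point lies on the sphere through the others. -/
def cosphericalTuples (d : ℕ) : Set (Fin (d + 1 + 1) → Space d) :=
  {z | Function.Injective z ∧ LinearIndependent ℝ (fun i : Fin d => z i.succ.succ - z 1) ∧
    ‖frameCenter (fun i : Fin d => z i.succ.succ - z 1) - (z 0 - z 1)‖ =
      ‖frameCenter (fun i : Fin d => z i.succ.succ - z 1)‖}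

lemma measurableSet_cosphericalTuples : MeasurableSet (cosphericalTuples d) := by
  have hb : Measurable fun (z : Fin (d + 1 + 1) → Space d) (i : Fin d) => z i.succ.succ - z 1 := by
    fun_prop
  have hc := measurable_frameCenter.comp hb
  refine (measurableSet_injective_tuples _).inter
    ((measurableSet_linearIndependent.preimage hb).inter (measurableSet_eq_fun ?_ hc.norm))
  exact (hc.sub (by fun_prop)).norm

lemma measurePreserving_cons (d n : ℕ) : MeasurePreserving
    (fun p : Space d × (Fin n → Space d) => (Fin.cons p.1 p.2 : Fin (n + 1) → Space d))
    (volume.prod volume) volume := by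
  have h := (volume_preserving_piFinSuccAbove (fun _ : Fin (n + 1) => Space d) 0).symm
  have heq : (fun p : Space d × (Fin n → Space d) => (Fin.cons p.1 p.2 : Fin (n + 1) → Space d)) =
      (MeasurableEquiv.piFinSuccAbove (fun _ : Fin (n + 1) => Space d) 0).symm := by
    funext p
    exact (Fin.insertNth_zero' p.1 p.2).symm
  rw [heq]
  exact h

/-- Fubini: with the other points fixed, the first one is confined to a sphere, which is null. -/
lemma volume_cosphericalTuples (hd : 1 ≤ d) : volume (cosphericalTuples d) = 0 := by
  have : Nontrivial (Space d) := Module.nontrivial_of_finrank_pos (R := ℝ) (by simp; omega)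
  have hmp := (measurePreserving_cons d (d + 1)).comp
    (Measure.measurePreserving_swap (μ := (volume : Measure (Fin (d + 1) → Space d)))
      (ν := (volume : Measure (Space d))))
  rw [← hmp.measure_preimage measurableSet_cosphericalTuples.nullMeasurableSet,
    Measure.measure_prod_null (hmp.measurable measurableSet_cosphericalTuples)]
  refine .of_forall fun f => ?_
  refine measure_mono_null (t := Metric.sphere
    (f 0 + frameCenter fun i : Fin d => f i.succ - f 0)
    ‖frameCenter fun i : Fin d => f i.succ - f 0‖) (fun x hx => ?_) (Measure.addHaar_sphere _ _ _)
  have h : ‖frameCenter (fun i : Fin d => f i.succ - f 0) - (x - f 0)‖ =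
    ‖frameCenter (fun i : Fin d => f i.succ - f 0)‖ := hx.2.2
  rw [mem_sphere_iff_norm, ← h, ← norm_neg]
  congr 1
  abel

namespace IsUnitPoissonProcess

/-- Almost surely, the process is in general position. -/
lemma ae_isGenericAt [IsProbabilityMeasure P] (hη : IsUnitPoissonProcess P η) (hd : 1 ≤ d) :
    ∀ᵐ ω ∂P, ∀ x ∈ η ω, IsGenericAt {w | x + w ∈ η ω} := by
  obtain ⟨hm, hi⟩ := hη.setLIntegral_tupleMeasure (measurableSet_cosphericalTuples (d := d))
    (fun z hz => hz.1) (U := ∅) .empty (by simp) (by simp)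
  rw [volume_cosphericalTuples hd, mul_zero] at hi
  have huniv : {ω : Ω | η ω ∩ ∅ = ∅} = univ := by ext; simp
  rw [huniv, Measure.restrict_univ, lintegral_eq_zero_iff hm] at hi
  filter_upwards [hi] with ω hω x hx b c hb hbη hc y hy hyc
  by_contra hcon
  rw [not_or] at hcon
  rw [Pi.zero_apply, tupleMeasure_apply (hη.countable ω),
    ENat.toENNReal_eq_zero, encard_eq_zero] at hω
  -- A failure of genericity is an injective cospherical tuple of points of the process, but the
  -- mean number of these is zero.
  have hmem : (Fin.cons (x + y) (Fin.cons x fun i => x + b i) : Fin (d + 1 + 1) → Space d) ∈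
      cosphericalTuples d ∩ univ.pi fun _ => η ω := by
    obtain rfl := (forall_norm_sub_eq_iff hb c).1 hc
    have hsub : (fun i : Fin d => x + b i - x) = b := funext fun i => add_sub_cancel_left x (b i)
    refine ⟨⟨?_, ?_, ?_⟩, ?_⟩
    · rw [Fin.cons_injective_iff, Fin.cons_injective_iff]
      refine ⟨?_, ?_, ?_⟩
      · rintro ⟨i, hi⟩
        revert hi
        refine Fin.cases ?_ (fun i => ?_) i
        · intro hi
          exact hcon.1 (by simpa using hi)
        · intro hi
          exact hcon.2 ⟨i, by simpa using hi⟩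
      · rintro ⟨i, hi⟩
        exact hb.ne_zero i (by simpa using hi)
      · exact (add_right_injective x).comp hb.injective
    · change LinearIndependent ℝ fun i : Fin d => x + b i - x
      rwa [hsub]
    · change ‖frameCenter (fun i : Fin d => x + b i - x) - (x + y - x)‖ =
        ‖frameCenter (fun i : Fin d => x + b i - x)‖
      rwa [hsub, add_sub_cancel_left]
    · intro i _
      refine Fin.cases hy (fun i => ?_) i
      refine Fin.cases hx (fun i => ?_) i
      exact hbη i
  rw [hω] at hmem
  exact hmem

end IsUnitPoissonProcess

end AlmostSure

/-! ### From the exponential of the flower volume to its unit sublevel set. -/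

section Scaling

variable {d : ℕ}

lemma measurable_volume_frameFlower {k : ℕ} (hk : 1 ≤ k) :
    Measurable fun y : Fin k → Space d => volume (frameFlower (range y)) := by
  have : Nonempty (Fin k) := ⟨⟨0, hk⟩⟩
  obtain ⟨G, b, hG, hb, -, h⟩ := exists_rectangles (measurableSet_frameTuples (d := d) k)
    measurable_frameCenter_comp fun J => (measurable_frameCenter_comp J).norm
  have hS : MeasurableSet (⋃ i, G i ×ˢ b i) := .iUnion fun i => (hG i).prod (hb i)
  convert! measurable_measure_prodMk_left (ν := (volume : Measure (Space d))) hS using 3 with y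
  have h1 : frameFlower (range y) = {w | ∃ i, y ∈ G i ∧ w ∈ b i} := by
    rw [h]
    ext w
    exact mem_frameFlower_range_iff y w
  rw [h1]
  ext w
  simp

lemma lintegral_exp_neg_Ioi (c : ℝ) :
    ∫⁻ t in Ioi c, ENNReal.ofReal (Real.exp (-t)) = ENNReal.ofReal (Real.exp (-c)) := by
  rw [← ofReal_integral_eq_lintegral_ofReal (integrableOn_exp_neg_Ioi c)
    (.of_forall fun t => (Real.exp_pos _).le), integral_exp_neg_Ioi]

lemma lintegral_exp_neg_mul_pow (k : ℕ) :
    ∫⁻ t in Ioi (0 : ℝ), ENNReal.ofReal (Real.exp (-t)) * ENNReal.ofReal (t ^ k) =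
      (k.factorial : ℝ≥0∞) := by
  have h1 : (k.factorial : ℝ≥0∞) = ENNReal.ofReal (Real.Gamma (k + 1)) := by
    rw [Real.Gamma_nat_eq_factorial, ENNReal.ofReal_natCast]
  have hint := Real.GammaIntegral_convergent (s := (k : ℝ) + 1) (by positivity)
  rw [h1, Real.Gamma_eq_integral (by positivity), ofReal_integral_eq_lintegral_ofReal hint]
  · refine setLIntegral_congr_fun measurableSet_Ioi fun t ht => ?_
    rw [← ENNReal.ofReal_mul (Real.exp_pos _).le, add_sub_cancel_right, Real.rpow_natCast]
  · refine (ae_restrict_iff' measurableSet_Ioi).2 (.of_forall fun t ht => ?_)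
    have : (0 : ℝ) < t := ht
    simp only [Pi.zero_apply]
    positivity

open scoped Pointwise

lemma volume_convexPosition_flower_le {k : ℕ} (hd : 1 ≤ d) {t : ℝ} (ht : 0 < t) :
    volume (convexPosition d k ∩ {y | volume (frameFlower (range y)) ≤ ENNReal.ofReal t}) =
      ENNReal.ofReal (t ^ k) *
        volume (convexPosition d k ∩ {y | volume (frameFlower (range y)) ≤ 1}) := by
  -- Dilation by `r` multiplies the flower volume by `r ^ d = t` and the volume of tuples by `r ^ (d
  -- * k) = t ^ k`.
  let r : ℝ := t ^ ((d : ℝ)⁻¹)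
  have hr : 0 < r := Real.rpow_pos_of_pos ht _
  have hrd : r ^ d = t := by
    rw [← Real.rpow_natCast, ← Real.rpow_mul ht.le, inv_mul_cancel₀ (by positivity),
      Real.rpow_one]
  have hset : convexPosition d k ∩ {y | volume (frameFlower (range y)) ≤ ENNReal.ofReal t} =
      r • (convexPosition d k ∩ {y | volume (frameFlower (range y)) ≤ 1}) := by
    ext y
    rw [mem_smul_set_iff_inv_smul_mem₀ hr.ne']
    obtain ⟨x, rfl⟩ : ∃ x, y = r • x := ⟨r⁻¹ • y, by rw [smul_inv_smul₀ hr.ne']⟩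
    rw [inv_smul_smul₀ hr.ne', mem_inter_iff, mem_inter_iff, smul_mem_convexPosition_iff hr]
    refine and_congr_right fun _ => ?_
    have h1 := phiContent_smul hr x
    rw [phiContent_insert_zero, phiContent_insert_zero, hrd] at h1
    change volume (frameFlower (range (r • x))) ≤ _ ↔ volume (frameFlower (range x)) ≤ 1
    rw [h1]
    nth_rewrite 2 [← mul_one (ENNReal.ofReal t)]
    exact ENNReal.mul_le_mul_iff_right (by simpa using ht) ENNReal.ofReal_ne_top
  rw [hset, Measure.addHaar_smul]
  congr 2
  have hfin : Module.finrank ℝ (Fin k → Space d) = d * k := by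
    rw [Module.finrank_pi_fintype]
    simp [mul_comm]
  rw [hfin, pow_mul, hrd, abs_of_pos (by positivity)]

/-- The scaling identity for the flower volume. -/
theorem lintegral_voidProb_convexPosition {k : ℕ} (hd : 1 ≤ d) (hk : 1 ≤ k) :
    ∫⁻ y in convexPosition d k, voidProb (frameFlower (range y)) =
      k.factorial * volume (convexPosition d k ∩ {y | volume (frameFlower (range y)) ≤ 1}) := by
  have hmeas := measurable_volume_frameFlower (d := d) hk
  -- Layer-cake form: `exp (-g)` is the integral of `exp (-t)` over `t ≥ g`. Swapping the integrals
  -- leaves a Gamma integral.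
  have h1 : ∀ y : Fin k → Space d, voidProb (frameFlower (range y)) =
      ∫⁻ t in Ioi (0 : ℝ), {p : (Fin k → Space d) × ℝ |
        volume (frameFlower (range p.1)) ≤ ENNReal.ofReal p.2}.indicator
          (fun p => ENNReal.ofReal (Real.exp (-p.2))) (y, t) := by
    intro y
    set g := (volume (frameFlower (range y))).toReal with hg
    have hg0 : 0 ≤ g := ENNReal.toReal_nonneg
    have hgof : volume (frameFlower (range y)) = ENNReal.ofReal g :=
      (ENNReal.ofReal_toReal (volume_frameFlower_range_ne_top y)).symm
    have h2 : ∀ t ∈ Ioi (0 : ℝ), {p : (Fin k → Space d) × ℝ |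
        volume (frameFlower (range p.1)) ≤ ENNReal.ofReal p.2}.indicator
          (fun p => ENNReal.ofReal (Real.exp (-p.2))) (y, t) =
        (Ici g).indicator (fun t => ENNReal.ofReal (Real.exp (-t))) t := by
      intro t ht
      simp only [indicator_apply, mem_ofPred_eq, hgof, mem_Ici,
        ENNReal.ofReal_le_ofReal_iff (le_of_lt ht)]
    rw [setLIntegral_congr_fun measurableSet_Ioi h2, lintegral_indicator measurableSet_Ici,
      Measure.restrict_restrict measurableSet_Ici, voidProb, ← hg, ← lintegral_exp_neg_Ioi]
    refine (setLIntegral_congr ?_).symm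
    have h3 : (Ici g ∩ Ioi 0 : Set ℝ) =ᵐ[volume] (Ioi g ∩ Ioi 0 : Set ℝ) :=
      Ioi_ae_eq_Ici.symm.inter (Filter.EventuallyEq.refl _ _)
    have h4 : Ioi g ∩ Ioi (0 : ℝ) = Ioi g := inter_eq_left.2 fun t ht => lt_of_le_of_lt hg0 ht
    rw [h4] at h3
    exact h3
  have hset : MeasurableSet {p : (Fin k → Space d) × ℝ |
      volume (frameFlower (range p.1)) ≤ ENNReal.ofReal p.2} :=
    measurableSet_le (hmeas.comp measurable_fst) (by fun_prop)
  have hm : Measurable ({p : (Fin k → Space d) × ℝ |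
      volume (frameFlower (range p.1)) ≤ ENNReal.ofReal p.2}.indicator
        (fun p => ENNReal.ofReal (Real.exp (-p.2)))) :=
    Measurable.indicator (by fun_prop) hset
  simp_rw [h1]
  rw [lintegral_lintegral_swap (f := fun y t => {p : (Fin k → Space d) × ℝ |
      volume (frameFlower (range p.1)) ≤ ENNReal.ofReal p.2}.indicator
        (fun p => ENNReal.ofReal (Real.exp (-p.2))) (y, t)) hm.aemeasurable, ← lintegral_exp_neg_mul_pow,
    ← lintegral_mul_const _ (by fun_prop)]
  refine setLIntegral_congr_fun measurableSet_Ioi fun t ht => ?_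
  have h5 : ∀ y : Fin k → Space d, {p : (Fin k → Space d) × ℝ |
      volume (frameFlower (range p.1)) ≤ ENNReal.ofReal p.2}.indicator
        (fun p => ENNReal.ofReal (Real.exp (-p.2))) (y, t) =
      {y | volume (frameFlower (range y)) ≤ ENNReal.ofReal t}.indicator
        (fun _ => ENNReal.ofReal (Real.exp (-t))) y := fun y => rfl
  have hms : MeasurableSet {y : Fin k → Space d |
      volume (frameFlower (range y)) ≤ ENNReal.ofReal t} := measurableSet_le hmeas measurable_const
  simp_rw [h5]
  rw [lintegral_indicator_const hms, Measure.restrict_apply hms, inter_comm,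
    volume_convexPosition_flower_le hd ht, mul_assoc]

end Scaling

/-! ### Orderings of a neighbour set. -/

section Enumeration

/-- The number of injective enumerations of a set by `Fin k`. -/
lemma encard_enumerations {α : Type*} (k : ℕ) (N : Set α) :
    {y : Fin k → α | Function.Injective y ∧ range y = N}.encard =
      {N : Set α | N.encard = k}.indicator (fun _ => (k.factorial : ℕ∞)) N := by
  classical
  by_cases hN : N.encard = k
  · rw [indicator_of_mem (show N ∈ {N : Set α | N.encard = k} from hN)]
    have hfin : N.Finite := finite_of_encard_eq_coe hN
    have := hfin.fintype
    have hcard : Fintype.card N = k := by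
      have h := hN
      rw [encard_eq_coe_toFinset_card, toFinset_card] at h
      exact_mod_cast h
    let e : {y : Fin k → α | Function.Injective y ∧ range y = N} ≃ (Fin k ≃ N) :=
      { toFun := fun y => (Equiv.ofInjective y.1 y.2.1).trans (Equiv.setCongr y.2.2)
        invFun := fun f => ⟨fun i => f i, Subtype.val_injective.comp f.injective, by
          ext a
          constructor
          · rintro ⟨i, rfl⟩; exact (f i).2
          · intro ha; exact ⟨f.symm ⟨a, ha⟩, by simp⟩⟩
        left_inv := fun y => rfl
        right_inv := fun f => by ext; rfl }
    rw [encard_congr (t := (univ : Set (Fin k ≃ N))) (e.trans (Equiv.Set.univ _).symm), encard_univ,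
      ENat.card_eq_coe_fintype_card,
      Fintype.card_equiv (Fintype.equivOfCardEq (by simp [hcard])), Fintype.card_fin]
  · rw [indicator_of_notMem (show N ∉ {N : Set α | N.encard = k} from hN), encard_eq_zero,
      eq_empty_iff_forall_notMem]
    rintro y ⟨hy, rfl⟩
    apply hN
    rw [← image_univ, hy.encard_image, encard_univ]
    simp

end Enumeration

/-! ### Counting neighbour tuples and conclusion. -/

section TypicalDegree

variable {d : ℕ}

/-- The tail of a tuple, seen from its first point. -/
def shiftedTail {k : ℕ} (z : Fin (k + 1) → Space d) : Fin k → Space d := fun i => z i.succ - z 0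

lemma measurable_shiftedTail {k : ℕ} : Measurable (shiftedTail (d := d) (k := k)) := by
  unfold shiftedTail
  fun_prop

/-- The tuples whose first point lies in `B` and whose tail surrounds it. -/
def windowTuples (B : Set (Space d)) (k : ℕ) : Set (Fin (k + 1) → Space d) :=
  {z | z 0 ∈ B ∧ shiftedTail z ∈ convexPosition d k}

/-- The flower of the first point of a tuple. -/
def tupleFlower {k : ℕ} (z : Fin (k + 1) → Space d) : Set (Space d) :=
  {w | w - z 0 ∈ frameFlower (range (shiftedTail z))}

lemma measurableSet_windowTuples {B : Set (Space d)} (hB : MeasurableSet B) {k : ℕ}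
    (hk : 1 ≤ k) : MeasurableSet (windowTuples B k) :=
  (hB.preimage (measurable_pi_apply 0)).inter
    ((measurableSet_convexPosition hk).preimage measurable_shiftedTail)

lemma injective_of_mem_windowTuples {B : Set (Space d)} {k : ℕ} {z : Fin (k + 1) → Space d}
    (hz : z ∈ windowTuples B k) : Function.Injective z := by
  obtain ⟨h1, h2, -⟩ := (mem_convexPosition_iff _).1 hz.2
  rw [← Fin.cons_self_tail z, Fin.cons_injective_iff]
  refine ⟨?_, fun i j hij => h1 ?_⟩
  · rintro ⟨i, hi⟩
    refine frameNeighbors_ne_zero (h2 ⟨i, rfl⟩) ?_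
    have : z i.succ = z 0 := hi
    simp [shiftedTail, this]
  · have : z i.succ = z j.succ := hij
    simp [shiftedTail, this]

/-- Frame centres lie in the Voronoi cell of the tuple. This is the avoidance hypothesis of the
Mecke formula: a tuple does not obstruct its own flower. -/
lemma notMem_tupleFlower {k : ℕ} (z : Fin (k + 1) → Space d) (j : Fin (k + 1)) :
    z j ∉ tupleFlower z := by
  rintro ⟨b, c, h, hlt⟩
  refine absurd hlt (not_lt.2 ?_)
  refine Fin.cases ?_ (fun i => ?_) j
  · simp
  · exact h.center_mem _ ⟨i, rfl⟩

lemma volume_tupleFlower {k : ℕ} (z : Fin (k + 1) → Space d) :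
    volume (tupleFlower z) = volume (frameFlower (range (shiftedTail z))) := by
  rw [← measure_preimage_add_right volume (-(z 0)) (frameFlower _)]
  simp only [← sub_eq_add_neg]
  rfl

/-- The integrand sees the first point only through membership in `B`, once the others are
translated by it. -/
lemma lintegral_windowTuples {B : Set (Space d)} (hB : MeasurableSet B) {k : ℕ} (hk : 1 ≤ k) :
    ∫⁻ z in windowTuples B k, voidProb (tupleFlower z) =
      volume B * ∫⁻ y in convexPosition d k, voidProb (frameFlower (range y)) := by
  have hC := measurableSet_convexPosition (d := d) hk
  have hvoid : Measurable fun y : Fin k → Space d => voidProb (frameFlower (range y)) := by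
    have := measurable_volume_frameFlower (d := d) hk
    unfold voidProb
    fun_prop
  let h : (Fin k → Space d) → ℝ≥0∞ :=
    (convexPosition d k).indicator fun y => voidProb (frameFlower (range y))
  have hh : Measurable h := hvoid.indicator hC
  have hA := measurableSet_windowTuples hB hk
  have h1 : ∀ z, (windowTuples B k).indicator (fun z => voidProb (tupleFlower z)) z =
      B.indicator 1 (z 0) * h (shiftedTail z) := by
    intro z
    have hv : voidProb (tupleFlower z) = voidProb (frameFlower (range (shiftedTail z))) := by
      rw [voidProb, voidProb, volume_tupleFlower]
    by_cases hz0 : z 0 ∈ B <;> by_cases hz1 : shiftedTail z ∈ convexPosition d k <;>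
      simp [h, windowTuples, hz0, hz1, hv]
  have hmeas : Measurable fun z : Fin (k + 1) → Space d =>
      (B.indicator 1 (z 0) : ℝ≥0∞) * h (shiftedTail z) :=
    ((measurable_one.indicator hB).comp (measurable_pi_apply 0)).mul
      (hh.comp measurable_shiftedTail)
  have hmeas' : Measurable fun p : Space d × (Fin k → Space d) =>
      (B.indicator 1 ((Fin.cons p.1 p.2 : Fin (k + 1) → Space d) 0) : ℝ≥0∞) *
        h (shiftedTail (Fin.cons p.1 p.2)) :=
    hmeas.comp (measurePreserving_cons d k).measurable
  rw [← lintegral_indicator hA, lintegral_congr h1,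
    ← (measurePreserving_cons d k).lintegral_comp hmeas, lintegral_prod _ hmeas'.aemeasurable]
  have h2 : ∀ (x : Space d), ∫⁻ y : Fin k → Space d,
      (B.indicator 1 ((Fin.cons x y : Fin (k + 1) → Space d) 0) : ℝ≥0∞) *
        h (shiftedTail (Fin.cons x y)) = B.indicator 1 x * ∫⁻ y, h y := by
    intro x
    have h3 : ∀ y : Fin k → Space d, h (shiftedTail (Fin.cons x y)) = h (y - fun _ => x) :=
      fun y => rfl
    simp_rw [h3, Fin.cons_zero]
    rw [lintegral_const_mul _ (by fun_prop), lintegral_sub_right_eq_self h]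
  simp_rw [h2]
  rw [lintegral_mul_const _ (measurable_one.indicator hB), lintegral_indicator_one hB,
    lintegral_indicator hC]

/-- The tuples counted by the degree: they enumerate the Delaunay neighbours of a point in `B`. -/
lemma windowTuples_inter_eq {χ B : Set (Space d)} (hd : 1 ≤ d) {k : ℕ} (hk : 1 ≤ k)
    (hχ : ∀ x, IsLocFinite {w | x + w ∈ χ}) (hsur : ∀ x, IsSurrounding {w | x + w ∈ χ})
    (hgen : ∀ x ∈ χ, IsGenericAt {w | x + w ∈ χ}) :
    windowTuples B k ∩ {z | χ ∩ tupleFlower z = ∅} ∩ univ.pi (fun _ => χ) =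
      {z | z 0 ∈ χ ∩ B ∧ Function.Injective (shiftedTail z) ∧
        range (shiftedTail z) = frameNeighbors {w | z 0 + w ∈ χ}} := by
  have : Nonempty (Fin k) := ⟨⟨0, hk⟩⟩
  have key : ∀ z : Fin (k + 1) → Space d, z 0 ∈ χ → range (shiftedTail z) ⊆ {w | z 0 + w ∈ χ} →
      Function.Injective (shiftedTail z) →
      ((shiftedTail z ∈ convexPosition d k ∧ χ ∩ tupleFlower z = ∅) ↔
        range (shiftedTail z) = frameNeighbors {w | z 0 + w ∈ χ}) := by
    intro z hz hsub hinj
    rw [← eq_frameNeighbors_iff hd (hχ _) (hsur _) (hgen _ hz) hsub (finite_range _)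
      (range_nonempty _), mem_convexPosition_iff, and_assoc, and_assoc,
      and_iff_right hinj]
    refine and_congr_right fun _ => and_congr_right fun _ => ?_
    -- An empty flower means that every frame centre is in the cell of the whole configuration.
    rw [eq_empty_iff_forall_notMem]
    constructor
    · intro h b c hbc w hw
      by_contra hlt
      refine h (z 0 + w) ⟨hw, b, c, hbc, ?_⟩
      rw [add_sub_cancel_left]
      exact not_le.1 hlt
    · rintro h w ⟨hw, b, c, hbc, hlt⟩
      exact absurd hlt (not_lt.2 (h b c hbc (w - z 0) (by simpa using hw)))
  ext z
  constructor
  · rintro ⟨⟨⟨h0, h1⟩, h2⟩, h3⟩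
    have hinj := ((mem_convexPosition_iff _).1 h1).1
    refine ⟨⟨h3 0 (mem_univ _), h0⟩, hinj, (key z (h3 0 (mem_univ _)) ?_ hinj).1 ⟨h1, h2⟩⟩
    rintro _ ⟨i, rfl⟩
    simpa [shiftedTail] using h3 i.succ (mem_univ _)
  · rintro ⟨⟨h0, h1⟩, hinj, h2⟩
    have hsub : range (shiftedTail z) ⊆ {w | z 0 + w ∈ χ} := h2 ▸ frameNeighbors_subset _
    obtain ⟨h3, h4⟩ := (key z h0 hsub hinj).2 h2
    refine ⟨⟨⟨h1, h3⟩, h4⟩, fun i _ => ?_⟩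
    refine Fin.cases h0 (fun i => ?_) i
    simpa [shiftedTail] using hsub ⟨i, rfl⟩

/-- Counting tuples that enumerate prescribed sets around their first point. -/
lemma encard_enumerating_tuples (S : Set (Space d)) (N : Space d → Set (Space d)) (k : ℕ) :
    (({z : Fin (k + 1) → Space d | z 0 ∈ S ∧ Function.Injective (shiftedTail z) ∧
        range (shiftedTail z) = N (z 0)}.encard : ℕ∞) : ℝ≥0∞) =
      k.factorial * ∑' x : S, {x : Space d | (N x).encard = k}.indicator (fun _ => 1) (x : Space d)
      := by
  let T := {z : Fin (k + 1) → Space d | z 0 ∈ S ∧ Function.Injective (shiftedTail z) ∧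
    range (shiftedTail z) = N (z 0)}
  let e : T ≃ Σ x : S, {y : Fin k → Space d | Function.Injective y ∧ range y = N x} :=
    { toFun := fun z => ⟨⟨z.1 0, z.2.1⟩, ⟨shiftedTail z.1, z.2.2⟩⟩
      invFun := fun p => ⟨Fin.cons (p.1 : Space d) fun i => p.1 + p.2.1 i, by
        have h : shiftedTail (Fin.cons (p.1 : Space d) fun i => p.1 + p.2.1 i) = p.2.1 := by
          funext i; simp [shiftedTail]
        refine ⟨p.1.2, ?_⟩
        rw [h]
        exact p.2.2⟩
      left_inv := fun z => by
        ext1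
        funext i
        refine Fin.cases rfl (fun i => ?_) i
        simp [shiftedTail]
      right_inv := fun p => by
        obtain ⟨x, y, hy⟩ := p
        have h : shiftedTail (Fin.cons (x : Space d) fun i => x + y i) = y := by
          funext i; simp [shiftedTail]
        exact Sigma.ext rfl (heq_of_eq (Subtype.ext h)) }
  have h1 : ((T.encard : ℕ∞) : ℝ≥0∞) = ∑' _ : T, (1 : ℝ≥0∞) := by simp
  change ((T.encard : ℕ∞) : ℝ≥0∞) = _
  rw [h1, ← e.symm.tsum_eq, ENNReal.tsum_sigma (β := fun x : S =>
    {y : Fin k → Space d | Function.Injective y ∧ range y = N x}) fun _ _ => 1,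
    ← ENNReal.tsum_mul_left]
  refine tsum_congr fun x => ?_
  have h2 : ∑' _ : {y : Fin k → Space d | Function.Injective y ∧ range y = N x}, (1 : ℝ≥0∞) =
      (({y : Fin k → Space d | Function.Injective y ∧ range y = N x}.encard : ℕ∞) : ℝ≥0∞) := by
    simp
  rw [h2, encard_enumerations]
  by_cases hx : (N x).encard = k <;> simp [hx]

variable {Ω : Type*} [MeasurableSpace Ω] {P : Measure Ω} {η : Ω → Set (Space d)}

lemma IsUnitPoissonProcess.isLocFinite (hη : IsUnitPoissonProcess P η) (ω : Ω) (x : Space d) :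
    IsLocFinite {w | x + w ∈ η ω} := by
  intro R
  have h := hη.locallyFinite ω (Metric.closedBall x R) Metric.isBounded_closedBall
  refine (h.image fun w => w - x).subset ?_
  rintro w ⟨hw, hR⟩
  refine ⟨x + w, ⟨hw, ?_⟩, by simp⟩
  simpa using hR

/-- The expected number of tuples enumerating the neighbours of a point in `B`. -/
lemma IsUnitPoissonProcess.lintegral_windowTuples [IsProbabilityMeasure P]
    (hη : IsUnitPoissonProcess P η) {B : Set (Space d)} (hB : MeasurableSet B) {k : ℕ}
    (hk : 1 ≤ k) :
    ∫⁻ ω, tupleMeasure (k + 1) (η ω) (windowTuples B k ∩ {z | η ω ∩ tupleFlower z = ∅}) ∂P =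
      ∫⁻ z in windowTuples B k, voidProb (tupleFlower z) := by
  have : Nonempty (Fin k) := ⟨⟨0, hk⟩⟩
  have hcen : ∀ J : Fin d → Fin k, Measurable fun z : Fin (k + 1) → Space d =>
      frameCenter (shiftedTail z ∘ J) := fun J =>
    (measurable_frameCenter_comp J).comp measurable_shiftedTail
  obtain ⟨G, b, hG, hb, hbv, h⟩ := exists_rectangles (Z := Fin (k + 1) → Space d)
    (fun J : Fin d → Fin k => (measurableSet_frameTuples k J).preimage measurable_shiftedTail)
    (C := fun J z => z 0 + frameCenter (shiftedTail z ∘ J))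
    (fun J => (measurable_pi_apply 0).add (hcen J)) (fun J => (hcen J).norm)
  have hF : ∀ z : Fin (k + 1) → Space d, {w | ∃ i, z ∈ G i ∧ w ∈ b i} = tupleFlower z := by
    intro z
    rw [h]
    ext w
    refine Iff.trans ?_ (mem_frameFlower_range_iff (shiftedTail z) (w - z 0)).symm
    refine exists_congr fun J => and_congr_right fun _ => ?_
    rw [dist_eq_norm, dist_eq_norm, sub_sub]
  have hmem : ∀ z i, z ∈ G i → b i ⊆ tupleFlower z := fun z i hi w hw =>
    hF z ▸ ⟨i, hi, hw⟩
  have hE := hη.lintegral_tupleMeasure hG hb hbv (measurableSet_windowTuples hB hk)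
    (fun z hz => injective_of_mem_windowTuples hz)
    (fun z _ i hi j hj => notMem_tupleFlower z j (hmem z i hi hj))
    (fun z _ => by rw [hF, volume_tupleFlower]; exact volume_frameFlower_range_ne_top _)
  simp_rw [hF] at hE
  rw [← hE]
  refine lintegral_congr fun ω => ?_
  congr 2
  ext z
  rw [mem_ofPred_eq, mem_ofPred_eq, ← hF, eq_empty_iff_forall_notMem]
  constructor
  · intro h' i hi
    rw [eq_empty_iff_forall_notMem]
    exact fun w hw => h' w ⟨hw.1, i, hi, hw.2⟩
  · rintro h' w ⟨hw, i, hi, hwi⟩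
    have := h' i hi
    rw [eq_empty_iff_forall_notMem] at this
    exact this w ⟨hw, hwi⟩

end TypicalDegree

theorem mainTheorem9 (d : ℕ) (hd : 2 ≤ d)
    {Ω : Type*} [MeasurableSpace Ω] (P : Measure Ω) [IsProbabilityMeasure P]
    (η : Ω → Set (Space d)) (hη : IsUnitPoissonProcess P η)
    (B : Set (Space d)) (hB : MeasurableSet B) (hB0 : 0 < volume B) (hB1 : volume B < ∞)
    (k : ℕ) (hk : 1 ≤ k) :
    typicalDegreeProb P η B k =
      ∫⁻ y in convexPosition d k,
        {y : Fin k → Space d | phiContent (insert 0 (range y)) 0 ≤ 1}.indicator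
          (fun _ => 1) y := by
  have hd1 : 1 ≤ d := by omega
  have hk0 : (k.factorial : ℝ≥0∞) ≠ 0 := by exact_mod_cast k.factorial_ne_zero
  have hkt : (k.factorial : ℝ≥0∞) ≠ ∞ := ENNReal.natCast_ne_top _
  have hcount : ∀ᵐ ω ∂P, ∑' x : ↥(η ω ∩ B),
      {x : Space d | delaunayDegree (η ω) x = k}.indicator (fun _ => 1) (x : Space d) =
      (k.factorial : ℝ≥0∞)⁻¹ * tupleMeasure (k + 1) (η ω)
        (windowTuples B k ∩ {z | η ω ∩ tupleFlower z = ∅}) := by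
    filter_upwards [hη.ae_isSurrounding hd1, hη.ae_isGenericAt hd1] with ω hsur hgen
    rw [tupleMeasure_apply (hη.countable ω), windowTuples_inter_eq hd1 hk (hη.isLocFinite ω) hsur hgen,
      encard_enumerating_tuples (η ω ∩ B) (fun x => frameNeighbors {w | x + w ∈ η ω}),
      ← mul_assoc, ENNReal.inv_mul_cancel hk0 hkt, one_mul]
    refine tsum_congr fun x => ?_
    simp only [indicator_apply, mem_ofPred_eq, delaunayDegree_eq x.2.1]
  have hms : MeasurableSet {y : Fin k → Space d | phiContent (insert 0 (range y)) 0 ≤ 1} := by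
    simp_rw [phiContent_insert_zero]
    exact measurableSet_le (measurable_volume_frameFlower hk) measurable_const
  -- Finiteness of `(k!)⁻¹` suffices to extract it, so no measurability of the tuple count is needed
  -- here.
  rw [typicalDegreeProb, lintegral_congr_ae hcount, lintegral_const_mul' _ _ (by simpa using hk0),
    hη.lintegral_windowTuples hB hk, lintegral_windowTuples hB hk,
    lintegral_voidProb_convexPosition hd1 hk, lintegral_indicator_const hms, one_mul,
    Measure.restrict_apply hms, inter_comm]
  simp_rw [phiContent_insert_zero]
  rw [mul_left_comm (volume B), ← mul_assoc (_)⁻¹ (k.factorial : ℝ≥0∞),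
    ENNReal.inv_mul_cancel hk0 hkt, one_mul, ← mul_assoc,
    ENNReal.inv_mul_cancel hB0.ne' hB1.ne, one_mul]
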